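/- **Setting.** An $(N,k)$ convolutional code over $\mathbb F_q$ is an $\mathbb F_q[D]$-submodule $\mathcal C\subseteq\mathbb F_q[D]^N$ of rank $k$; a $k\times N$ polynomial matrix $G(D)$ is a generator matrix if $\mathcal C=\{x(D)G(D)\}$. The row degree $\nu_i(G)$ is the largest degree in row $i$, the memory of $G$ is $\max_i\nu_i(G)$, the degree $\delta(\mathcal C)$ is the minimum of $\sum_i\nu_i(G)$ over all generator matrices, and $G$ is reduced if it attains it. The column distance $d^c_j(\mathcal C)$ is the minimum Hamming weight of $(c_0,\dots,c_j)$ over codewords $\sum_t c_tD^t\in\mathcal C$ with $c_0\ne0$. For $1\le k<N$ put $L(\mathcal C)=\lfloor\delta(\mathcal C)/k\rfloor+\lfloor\delta(\mathcal C)/(N-k)\rfloor$; $\mathcal C$ is MDP if $d^c_{L(\mathcal C)}(\mathcal C)=(N-k)(L(\mathcal C)+1)+1$. An $(n,M)$ trellis code over a finite alphabet $\Sigma$ is the set of all label sequences of infinite paths from a fixed initial state in a finite digraph with edge labels in $\Sigma^n$ (a generator digraph) that is irreducible, lossless (distinct paths with the same initial and the same terminal state have different label sequences) and $M$-regular (each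 state has $M$ outgoing edges). Its rate is $\log_{|\Sigma|}M/n$, its degree $\delta$ is the minimum of $\log_{|\Sigma|}|V|$ over its generator digraphs (with state set $V$), $d_{\rm free}$ is the minimum Hamming distance of two distinct codewords, and $d^c_j$ is the minimum Hamming distance of $(c_0,\dots,c_j)$ and $(c_0',\dots,c_j')$ over codewords with $c_0\ne c_0'$ (defined when some generator digraph is deterministic, i.e. edges leaving the same state have distinct labels). Minima over the empty set are $\infty$. A $\Delta$-regular balanced bipartite graph is a $(\Delta,\gamma)$ spectral expander ($0\le\gamma\le1$) if all eigenvalues of its adjacency matrix, apart from one copy each of the trivial eigenvalues $\pm\Delta$, are at most $\Delta\gamma$ in absolute value. **Construction.** Let $1\le k<\Delta$, let $\mathcal C$ be a $(\Delta,k)$ MDP convolutional code over $\mathbb F_q$ with a reduced generator matrix $G(D)=\sum_{j=0}^mG_jD^j$ of memory $m$, with equal row degrees and with $G_0$ of full rank. Let $\mathcal B_1$ be the block code of length $(m+1)\Delta$ generated by $(G_0,\dots,G_m)$, and let $\mathcal B_2$ be a linear block code of length $\Delta$ over $\mathbb F_q$ with rate $r>0$ and relative minimum distance $\theta$. Let $\mathcal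 G_0$ be a $(\Delta,\gamma)$ spectral expander with parts $\{u_1,\dots,u_n\}$, $\{v_1,\dots,v_n\}$ ($n\ge1$), edge set $E$ and an arbitrary total order on $E$; for $w$ a vertex and $x\in\mathbb F_q^E$ let $x_w\in\mathbb F_q^\Delta$ be the restriction of $x$ to the edges at $w$, read in this order. Let $\mathcal B$ be the set of all $(b_0,\dots,b_m)\in(\mathbb F_q^E)^{m+1}$ such that, for all $s$ and $j$, $((b_0)_{v_s},\dots,(b_m)_{v_s})\in\mathcal B_1$ and $(b_j)_{u_s}\in\mathcal B_2$. Let $(\tilde G_0,\dots,\tilde G_m)$ be a generator matrix of $\mathcal B$ (rows a basis of $\mathcal B$), and let $\tilde{\mathcal C}$ consist of all sequences $(c_t)_{t\ge0}$ in $\mathbb F_q^E$ of the form $c_t=\sum_{i=0}^{\min(m,t)}x_{t-i}\tilde G_i$. For an $\mathbb F_q$-linear bijection $\phi:\mathcal B_2\to\mathbb F_{q^{r\Delta}}$, let $\tilde{\mathcal C}_\phi$ be the set of sequences $\big(\phi((c_t)_{u_1}),\dots,\phi((c_t)_{u_n})\big)_{t\ge0}$ with $(c_t)\in\tilde{\mathcal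 C}$. **Theorem.** (1) For all $m\ge0$ and $\varepsilon>0$ there is $\eta>0$, depending only on $m$ and $\varepsilon$, such that for all data as above (any $q,\Delta,k,\mathcal C,n,\mathcal G_0,\mathcal B_2,\phi$) with $G(D)$ of memory $m$, $r\ge1-\eta$ and $\gamma\le\eta\sqrt\theta$, the code $\tilde{\mathcal C}_\phi$ is, for some $M$, an $(n,M)$ trellis code over the alphabet $\mathbb F_{q^{r\Delta}}$ that has a deterministic $M$-regular generator digraph, and $$\frac{\delta(\tilde{\mathcal C}_\phi)}n\le\frac{\delta(\mathcal C)}\Delta+\varepsilon,\qquad\Big|\frac{\log_{q^{r\Delta}}M}n-\frac k\Delta\Big|\le\varepsilon,$$ $$\frac{d^c_j(\tilde{\mathcal C}_\phi)}{(j+1)n}\ge1-\frac k\Delta-\varepsilon\quad\text{and}\quad\frac{d_{\rm free}(\tilde{\mathcal C}_\phi)}{(j+1)n}\ge1-\frac k\Delta-\varepsilon\qquad\text{for all }0\le j\le L(\mathcal C).$$ (2) For each fixed $\mathcal C$ and $G(D)$ there is $\eta>0$ such that for all $n,\mathcal G_0,\mathcal B_2,\phi$ with $r\ge1-\eta$ and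 $\gamma\le\eta$ the conclusions of (1) hold with $\varepsilon=0$. -/

import Mathlib

open Polynomial Matrix
open scoped ENNReal

universe u v

noncomputable section

namespace ExpanderTrellis

/-! ### Convolutional codes -/

section Convolutional

variable {F : Type u} [Field F] {k n : ℕ}

/-- An `(n, k)` convolutional code over `F`: an `F[D]`-submodule of `F[D]^n` of rank `k`. -/
def IsConvCode (k : ℕ) (C : Submodule F[X] (Fin n → F[X])) : Prop :=
  Module.finrank F[X] C = k

/-- `G(D)` is a generator matrix of `C`: the code is the set of all `x(D) G(D)`. -/
def IsGeneratorMatrix (C : Submodule F[X] (Fin n → F[X])) (G : Matrix (Fin k) (Fin n) F[X]) :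
    Prop :=
  (C : Set (Fin n → F[X])) = Set.range fun x : Fin k → F[X] => x ᵥ* G

/-- The `i`-th row degree. -/
def rowDegree (G : Matrix (Fin k) (Fin n) F[X]) (i : Fin k) : ℕ :=
  Finset.univ.sup fun j => (G i j).natDegree

/-- The memory: the largest row degree. -/
def memory (G : Matrix (Fin k) (Fin n) F[X]) : ℕ :=
  Finset.univ.sup (rowDegree G)

/-- The overall constraint length: the sum of the row degrees. -/
def constraintLength (G : Matrix (Fin k) (Fin n) F[X]) : ℕ :=
  ∑ i, rowDegree G i

/-- The degree `δ(C)` of an `(n, k)` convolutional code: the least overall constraint length of a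
`k × n` generator matrix. -/
def convDegree (k : ℕ) (C : Submodule F[X] (Fin n → F[X])) : ℕ :=
  sInf {d | ∃ G : Matrix (Fin k) (Fin n) F[X], IsGeneratorMatrix C G ∧ constraintLength G = d}

/-- A reduced generator matrix of `C`. -/
def IsReducedGenerator (C : Submodule F[X] (Fin n → F[X])) (G : Matrix (Fin k) (Fin n) F[X]) :
    Prop :=
  IsGeneratorMatrix C G ∧ constraintLength G = convDegree k C

/-- The coefficient matrix `G_j` of `G(D) = ∑ G_j D^j`. -/
def coeffMatrix (G : Matrix (Fin k) (Fin n) F[X]) (j : ℕ) : Matrix (Fin k) (Fin n) F :=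
  G.map fun p => p.coeff j

/-- The code block `c_t` at time `t` of a polynomial codeword `c(D)`. -/
def block (c : Fin n → F[X]) (t : ℕ) : Fin n → F := fun i => (c i).coeff t

open Classical in
/-- The `j`-th column distance of a convolutional code: the minimum of `wt(c_0, …, c_j)` over the
codewords with `c_0 ≠ 0`. -/
def convColumnDist (C : Submodule F[X] (Fin n → F[X])) (j : ℕ) : ℕ∞ :=
  ⨅ c ∈ C, ⨅ _ : block c 0 ≠ 0,
    ((∑ t ∈ Finset.range (j + 1), hammingNorm (block c t) : ℕ) : ℕ∞)

/-- The maximum profile length `L(C) = ⌊δ(C)/k⌋ + ⌊δ(C)/(n-k)⌋`. -/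
def profileLength (k : ℕ) (C : Submodule F[X] (Fin n → F[X])) : ℕ :=
  convDegree k C / k + convDegree k C / (n - k)

/-- Maximum distance profile: the `L(C)`-th column distance attains the bound
`(n-k)(j+1)+1` (used for `k < n`). -/
def IsMDP (k : ℕ) (C : Submodule F[X] (Fin n → F[X])) : Prop :=
  convColumnDist C (profileLength k C) = (((n - k) * (profileLength k C + 1) + 1 : ℕ) : ℕ∞)

end Convolutional

/-! ### Trellis codes -/

/-- A finite digraph (parallel edges and loops allowed) with edges labelled in `L`. -/
structure LabeledDigraph (L : Type v) where
  V : Type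
  E : Type
  finV : Finite V
  nonemptyV : Nonempty V
  finE : Finite E
  src : E → V
  tgt : E → V
  label : E → L

namespace LabeledDigraph

variable {L : Type v} (Γ : LabeledDigraph L)

/-- The list of edges `p` is a path from `a` to `b`. -/
def IsPath : Γ.V → List Γ.E → Γ.V → Prop
  | a, [], b => a = b
  | a, e :: p, b => Γ.src e = a ∧ IsPath (Γ.tgt e) p b

def Irreducible : Prop := ∀ a b, ∃ p, Γ.IsPath a p b

/-- Distinct paths with the same initial state and the same terminal state have different label
sequences. -/
def Lossless : Prop :=
  ∀ a b p p', Γ.IsPath a p b → Γ.IsPath a p' b → p ≠ p' → p.map Γ.label ≠ p'.map Γ.label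

/-- Every state has exactly `M` outgoing edges. -/
def Regular (M : ℕ) : Prop := ∀ a, {e | Γ.src e = a}.ncard = M

/-- No two outgoing edges of a state carry the same label. -/
def Deterministic : Prop :=
  ∀ e e', Γ.src e = Γ.src e' → Γ.label e = Γ.label e' → e = e'

/-- All label sequences of infinite paths that start in `a`. -/
def sequences (a : Γ.V) : Set (ℕ → L) :=
  {c | ∃ p : ℕ → Γ.E, Γ.src (p 0) = a ∧ (∀ t, Γ.tgt (p t) = Γ.src (p (t + 1))) ∧
    ∀ t, c t = Γ.label (p t)}

/-- `Γ` is a generator digraph of `C` as a trellis code of size `M`. -/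
def IsGenerator (M : ℕ) (C : Set (ℕ → L)) : Prop :=
  Γ.Irreducible ∧ Γ.Lossless ∧ Γ.Regular M ∧ ∃ a, C = Γ.sequences a

end LabeledDigraph

section Trellis

variable {A : Type v} {n : ℕ}

/-- `C` is an `(n, M)` trellis code over the alphabet `A`. -/
def IsTrellisCode (M : ℕ) (C : Set (ℕ → Fin n → A)) : Prop :=
  ∃ Γ : LabeledDigraph (Fin n → A), Γ.IsGenerator M C

/-- The degree of a trellis code: the minimum of `log_{|A|} |V|` over its generator digraphs. -/
def trellisDegree (C : Set (ℕ → Fin n → A)) : ℝ :=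
  sInf {d | ∃ Γ : LabeledDigraph (Fin n → A), (∃ M, Γ.IsGenerator M C) ∧
    d = Real.logb (Nat.card A) (Nat.card Γ.V)}

open Classical in
/-- The `j`-th column distance of a trellis code (with minimum `∞` over the empty set). -/
def columnDist (C : Set (ℕ → Fin n → A)) (j : ℕ) : ℕ∞ :=
  ⨅ c ∈ C, ⨅ c' ∈ C, ⨅ _ : c 0 ≠ c' 0,
    ((∑ t ∈ Finset.range (j + 1), hammingDist (c t) (c' t) : ℕ) : ℕ∞)

open Classical in
/-- The Hamming distance `∑_{t ≥ 0} d(c_t, c'_t)` of two infinite sequences, possibly infinite. -/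
def seqDist (c c' : ℕ → Fin n → A) : ℕ∞ :=
  ⨆ T : ℕ, ((∑ t ∈ Finset.range T, hammingDist (c t) (c' t) : ℕ) : ℕ∞)

/-- The free distance of a trellis code (with minimum `∞` over the empty set). -/
def freeDist (C : Set (ℕ → Fin n → A)) : ℕ∞ :=
  ⨅ c ∈ C, ⨅ c' ∈ C, ⨅ _ : c ≠ c', seqDist c c'

end Trellis

/-! ### Block codes -/

section Block

variable {F : Type u} [Field F] {n : ℕ}

/-- The rate of a block linear code. -/
def rate (B : Submodule F (Fin n → F)) : ℝ := (Module.finrank F B : ℝ) / n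

open Classical in
/-- The relative minimum distance of a (nonzero) block linear code. -/
def relDist (B : Submodule F (Fin n → F)) : ℝ :=
  ((sInf {w | ∃ c ∈ B, c ≠ 0 ∧ hammingNorm c = w} : ℕ) : ℝ) / n

end Block

/-! ### Bipartite graphs -/

/-- A `Δ`-regular balanced bipartite graph on `2n` vertices, with a total order on its edges.
The vertex `u_s` is `Sum.inl s` and the vertex `v_s` is `Sum.inr s`. -/
structure BipartiteGraph (n Δ : ℕ) where
  graph : SimpleGraph (Fin n ⊕ Fin n)
  bipartite : graph.IsBipartiteWith (Set.range Sum.inl) (Set.range Sum.inr)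
  regular : ∀ w, (graph.neighborSet w).ncard = Δ
  order : LinearOrder graph.edgeSet

namespace BipartiteGraph

variable {n Δ : ℕ} (Gr : BipartiteGraph n Δ)

/-- The edges of the graph. -/
def Edge : Type := Gr.graph.edgeSet

instance : LinearOrder Gr.Edge := Gr.order

instance : Fintype Gr.Edge := Fintype.ofFinite Gr.graph.edgeSet

open Classical in
/-- The set of edges incident with a vertex. -/
def incident (w : Fin n ⊕ Fin n) : Finset Gr.Edge :=
  Finset.univ.filter fun e => w ∈ e.1

open Classical in
theorem card_incident (w : Fin n ⊕ Fin n) : (Gr.incident w).card = Δ := by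
  have h1 : (Gr.graph.incidenceSet w).ncard = (Gr.graph.neighborSet w).ncard := by
    rw [← Nat.card_coe_set_eq, ← Nat.card_coe_set_eq]
    exact Nat.card_congr (Gr.graph.incidenceSetEquivNeighborSet w)
  refine Eq.trans ?_ (h1.trans (Gr.regular w))
  refine (Set.ncard_coe_finset _).symm.trans ?_
  refine Set.ncard_congr (fun e _ => e.1) ?_ ?_ ?_
  · intro e he
    exact ⟨e.2, by simpa [incident] using he⟩
  · intro a b _ _ h
    exact Subtype.ext h
  · intro e he
    exact ⟨⟨e, he.1⟩, Finset.mem_coe.2 (Finset.mem_filter.2 ⟨Finset.mem_univ _, he.2⟩), rfl⟩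

/-- The subword of `x` on the edges incident with `w`, read in the order of the edges. -/
def subword {F : Type u} (w : Fin n ⊕ Fin n) (x : Gr.Edge → F) : Fin Δ → F :=
  fun i => x ((Gr.incident w).orderEmbOfFin (Gr.card_incident w) i)

open Classical in
/-- A bipartite `(Δ, γ)` spectral expander: every eigenvalue of the adjacency matrix, apart from one
copy each of the trivial eigenvalues `Δ` and `-Δ` of a `Δ`-regular bipartite graph, is at most `Δγ`
in absolute value. -/
def IsSpectralExpander (γ : ℝ) : Prop :=
  0 ≤ γ ∧ γ ≤ 1 ∧
    ∀ x ∈ (((Gr.graph.adjMatrix ℝ).charpoly.roots).erase (Δ : ℝ)).erase (-(Δ : ℝ)), |x| ≤ Δ * γ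

end BipartiteGraph

/-! ### The construction -/

section Construction

variable {F : Type u} [Field F] {k n Δ m : ℕ}

/-- The block code `B₁` of length `(m+1)Δ` with generator matrix `(G_0, …, G_m)`. -/
def codeB1 (m : ℕ) (G : Matrix (Fin k) (Fin Δ) F[X]) : Submodule F (Fin (m + 1) → Fin Δ → F) :=
  Submodule.span F (Set.range fun (i : Fin k) (j : Fin (m + 1)) => coeffMatrix G j i)

/-- The block code `B`. The coordinate `c j e` sits on the copy in the `j`-th graph of the edge `e`;
all copies carry the same edge order. -/
def codeB (m : ℕ) (Gr : BipartiteGraph n Δ) (G : Matrix (Fin k) (Fin Δ) F[X])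
    (B2 : Submodule F (Fin Δ → F)) : Submodule F (Fin (m + 1) → Gr.Edge → F) where
  carrier := {c | (∀ s : Fin n, (fun j => Gr.subword (Sum.inr s) (c j)) ∈ codeB1 m G) ∧
    ∀ (s : Fin n) (j : Fin (m + 1)), Gr.subword (Sum.inl s) (c j) ∈ B2}
  add_mem' := fun ha hb =>
    ⟨fun s => (codeB1 m G).add_mem (ha.1 s) (hb.1 s), fun s j => B2.add_mem (ha.2 s j) (hb.2 s j)⟩
  zero_mem' := ⟨fun _ => (codeB1 m G).zero_mem, fun _ _ => B2.zero_mem⟩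
  smul_mem' := fun a _ hc =>
    ⟨fun s => (codeB1 m G).smul_mem a (hc.1 s), fun s j => B2.smul_mem a (hc.2 s j)⟩

/-- `(G̃_0, …, G̃_m)` is a generator matrix of the block code `B`: its rows form a basis of `B`. -/
def IsBlockGenerator {E : Type} {kt : ℕ} (B : Submodule F (Fin (m + 1) → E → F))
    (Gt : Fin (m + 1) → Matrix (Fin kt) E F) : Prop :=
  LinearIndependent F (fun (i : Fin kt) (j : Fin (m + 1)) => Gt j i) ∧
    Submodule.span F (Set.range fun (i : Fin kt) (j : Fin (m + 1)) => Gt j i) = B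

/-- The codewords, as semi-infinite sequences, of the convolutional code with generator matrix
`∑ G̃_i D^i`: `c_t = x_t G̃_0 + x_{t-1} G̃_1 + ⋯ + x_{t-m} G̃_m` with `x_t = 0` for `t < 0`. -/
def convSequences {E : Type} {kt : ℕ} (Gt : Fin (m + 1) → Matrix (Fin kt) E F) :
    Set (ℕ → E → F) :=
  {c | ∃ x : ℕ → Fin kt → F, ∀ t,
    c t = ∑ i : Fin (m + 1), if (i : ℕ) ≤ t then x (t - i) ᵥ* Gt i else 0}

/-- The code `C̃_φ`: the sequences `(φ^n(c_t))_t` with `c` in the code generated by `∑ G̃_i D^i`,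
where the `s`-th entry of `φ^n(c_t)` is `φ` of the subword of `c_t` at the vertex `u_s`. -/
def codePhi {K : Type v} [Field K] [Algebra F K] {kt : ℕ} (Gr : BipartiteGraph n Δ)
    (B2 : Submodule F (Fin Δ → F)) (φ : B2 ≃ₗ[F] K)
    (Gt : Fin (m + 1) → Matrix (Fin kt) Gr.Edge F) : Set (ℕ → Fin n → K) :=
  {Y | ∃ c ∈ convSequences Gt, ∀ t s, ∃ h : Gr.subword (Sum.inl s) (c t) ∈ B2, Y t s = φ ⟨_, h⟩}

end Construction

/-- The asserted parameters, up to an error `ε`, of a code `Y` of length `n` over the alphabet `K`,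
in terms of a `(Δ, k)` convolutional code of degree `δ` and maximum profile length `L`: `Y` is an
`(n, M)` trellis code (with a deterministic generator digraph, so that its column distances are
defined), and its relative degree, rate, column distances and free distance are as claimed. -/
def HasParameters {K : Type v} {n : ℕ} (Δ k δ L : ℕ) (Y : Set (ℕ → Fin n → K)) (ε : ℝ) : Prop :=
  ∃ M : ℕ,
    IsTrellisCode M Y ∧
    (∃ Γ : LabeledDigraph (Fin n → K), Γ.IsGenerator M Y ∧ Γ.Deterministic) ∧
    trellisDegree Y / n ≤ (δ : ℝ) / Δ + ε ∧
    |Real.logb (Nat.card K) M / n - (k : ℝ) / Δ| ≤ ε ∧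
    (∀ j ≤ L, ENNReal.ofReal (1 - (k : ℝ) / Δ - ε) ≤
      (columnDist Y j : ℝ≥0∞) / ((((j + 1) * n : ℕ)) : ℝ≥0∞)) ∧
    (∀ j ≤ L, ENNReal.ofReal (1 - (k : ℝ) / Δ - ε) ≤
      (freeDist Y : ℝ≥0∞) / ((((j + 1) * n : ℕ)) : ℝ≥0∞))

end ExpanderTrellis

end

/-! By linearity and injectivity of φ, the distance of two codewords at time t is |T_t|, where T_t
is the set of left vertices at which the difference c_t of the underlying words is nonzero. Suppose
the input x_0 of the difference is nonzero, and let S be the set of right vertices active at time 0.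
At each vertex of S the restrictions of c_0, c_1, … are the output of the encoder G(D) with nonzero
input at time 0, so up to time j ≤ L(C) they contain at least (Δ-k)(j+1)+1 nonzero symbols
(`le_sum_hammingNorm_encode`). A nonzero symbol at time t on an edge at S leads to T_t. The expander
mixing lemma (`BipartiteGraph.edgeCount_le`) therefore gives |S|((Δ-k)(j+1)+1) ≤ ∑_t Δ(|S||T_t|/n +
γ√(|S||T_t|)). If γ√n ≤ ε√|S|, each error term is at most ε|S|, and dividing by |S|Δ/n yields ∑|T_t|
≥ (1-k/Δ-ε)(j+1)n + n/Δ (`le_sum_card_leftSupport`).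

It remains to see that S is not too small (`gamma_mul_sqrt_le`). At time 0 there are two counts: a
vertex of S has at least Δ-k edges into T_0, and a vertex of T_0 has at least θΔ edges into S.
Applying mixing to both excludes a small S as soon as γ ≤ (ε/4)√θ.

Rate and degree come from dimension counts. With d = dim B₂, the dimension of B lies between nk -
n(m+1)(Δ-d) and nk. Since G_0 has full rank, G̃_0 is injective on inputs, so the shift register with
m memory cells is a deterministic generator digraph (`exists_generator`); equal row degrees give
δ(C) = km.

For a fixed code, a rate close enough to 1 forces d = Δ, and the surplus n/Δ, which stems from the
+1 in the MDP bound, absorbs the remaining error. -/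

noncomputable section

namespace ExpanderTrellis

/-! ### The expander mixing lemma -/

section Mixing

/-- Parseval's identity for the orthonormal eigenvector basis of a symmetric matrix. -/
theorem sum_eigenvectorBasis_dotProduct {V : Type*} [Fintype V] [DecidableEq V]
    {A : Matrix V V ℝ} (hA : A.IsHermitian) (x y : V → ℝ) :
    ∑ i, (⇑(hA.eigenvectorBasis i) ⬝ᵥ x) * (⇑(hA.eigenvectorBasis i) ⬝ᵥ y) = x ⬝ᵥ y := by
  have h := hA.eigenvectorBasis.sum_inner_mul_inner (WithLp.toLp 2 x) (WithLp.toLp 2 y)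
  simp only [EuclideanSpace.inner_eq_star_dotProduct, star_trivial] at h
  rw [dotProduct_comm x y]
  refine Eq.trans (Finset.sum_congr rfl fun i _ => ?_) h
  rw [dotProduct_comm _ y]

/-- A symmetric real matrix whose eigenvalues are bounded by `c` defines a bilinear form of norm at
most `c`. -/
theorem abs_dotProduct_mulVec_le {V : Type*} [Fintype V] [DecidableEq V]
    {A : Matrix V V ℝ} (hA : A.IsHermitian) {c : ℝ} (hc : 0 ≤ c)
    (h : ∀ (μ : ℝ) (x : V → ℝ), x ≠ 0 → A *ᵥ x = μ • x → |μ| ≤ c) (x y : V → ℝ) :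
    |x ⬝ᵥ A *ᵥ y| ≤ c * (√(x ⬝ᵥ x) * √(y ⬝ᵥ y)) := by
  set b : V → V → ℝ := fun i => ⇑(hA.eigenvectorBasis i) with hb
  have hsymm : ∀ z : V → ℝ, ∀ i, b i ⬝ᵥ A *ᵥ z = hA.eigenvalues i * (b i ⬝ᵥ z) := by
    intro z i
    rw [dotProduct_mulVec, ← mulVec_transpose]
    have : Aᵀ = A := (conjTranspose_eq_transpose_of_trivial A).symm.trans hA.eq
    rw [this]
    have h2 := hA.mulVec_eigenvectorBasis i
    rw [hb, h2, smul_dotProduct, smul_eq_mul]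
  have hev : ∀ i, |hA.eigenvalues i| ≤ c := by
    intro i
    refine h _ (b i) ?_ (hA.mulVec_eigenvectorBasis i)
    intro h0
    have := hA.eigenvectorBasis.orthonormal.ne_zero i
    exact this (by ext j; exact congrFun h0 j)
  have hsum : x ⬝ᵥ A *ᵥ y = ∑ i, hA.eigenvalues i * ((b i ⬝ᵥ x) * (b i ⬝ᵥ y)) := by
    rw [← sum_eigenvectorBasis_dotProduct hA x]
    refine Finset.sum_congr rfl fun i _ => ?_
    have := hsymm y i
    simp only [hb] at this ⊢
    rw [this]
    ring
  have hnorm : ∀ z : V → ℝ, ∑ i, |b i ⬝ᵥ z| ^ 2 = z ⬝ᵥ z := by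
    intro z
    rw [← sum_eigenvectorBasis_dotProduct hA z z]
    exact Finset.sum_congr rfl fun i _ => by rw [sq_abs, sq]
  calc |x ⬝ᵥ A *ᵥ y| ≤ ∑ i, |hA.eigenvalues i * ((b i ⬝ᵥ x) * (b i ⬝ᵥ y))| := by
        rw [hsum]; exact Finset.abs_sum_le_sum_abs _ _
    _ ≤ ∑ i, c * (|b i ⬝ᵥ x| * |b i ⬝ᵥ y|) := by
        refine Finset.sum_le_sum fun i _ => ?_
        rw [abs_mul, abs_mul]
        exact mul_le_mul_of_nonneg_right (hev i) (by positivity)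
    _ = c * ∑ i, |b i ⬝ᵥ x| * |b i ⬝ᵥ y| := by rw [Finset.mul_sum]
    _ ≤ c * (√(x ⬝ᵥ x) * √(y ⬝ᵥ y)) := by
        refine mul_le_mul_of_nonneg_left ?_ hc
        rw [← hnorm x, ← hnorm y]
        exact Real.sum_mul_le_sqrt_mul_sqrt _ _ _

/-- The geometric multiplicity of an eigenvalue is at most its algebraic multiplicity. -/
theorem card_le_count_roots_charpoly {V ι : Type*} [Fintype V] [DecidableEq V] [Fintype ι]
    {A : Matrix V V ℝ} {μ : ℝ} {x : ι → V → ℝ} (hx : LinearIndependent ℝ x)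
    (h : ∀ i, A *ᵥ x i = μ • x i) : Fintype.card ι ≤ A.charpoly.roots.count μ := by
  rw [count_roots]
  have h1 := LinearMap.finrank_eigenspace_le (Matrix.toLin' A) μ
  rw [Matrix.charpoly_toLin'] at h1
  refine le_trans ?_ h1
  have hmem : ∀ i, x i ∈ Module.End.eigenspace (Matrix.toLin' A) μ := fun i => by
    rw [Module.End.mem_eigenspace_iff, Matrix.toLin'_apply, h i]
  have : LinearIndependent ℝ
      (fun i => (⟨x i, hmem i⟩ : Module.End.eigenspace (Matrix.toLin' A) μ)) :=
    LinearIndependent.of_comp (Module.End.eigenspace (Matrix.toLin' A) μ).subtype hx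
  exact this.fintype_card_le_finrank

theorem linearIndependent_pair_of_dotProduct_eq_zero {V : Type*} [Fintype V] {x y : V → ℝ}
    (hx : x ≠ 0) (hy : y ≠ 0) (h : x ⬝ᵥ y = 0) : LinearIndependent ℝ ![x, y] := by
  rw [LinearIndependent.pair_iff]
  intro a b hab
  have h1 := congrArg (x ⬝ᵥ ·) hab
  have h2 := congrArg (y ⬝ᵥ ·) hab
  simp only [dotProduct_add, dotProduct_smul, h, dotProduct_comm y x, dotProduct_zero,
    smul_eq_mul, mul_zero, add_zero, zero_add, mul_eq_zero, dotProduct_self_eq_zero, hx, hy,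
    or_false] at h1 h2
  exact ⟨h1, h2⟩

/-! ### Spectrum and edge distribution of a regular bipartite graph -/

variable {n Δ : ℕ} (Gr : BipartiteGraph n Δ)

namespace BipartiteGraph

theorem not_adj_inl_inl (a b : Fin n) : ¬ Gr.graph.Adj (Sum.inl a) (Sum.inl b) := by
  intro h
  have := Gr.bipartite.mem_of_mem_adj ⟨a, rfl⟩ h
  simp at this

theorem not_adj_inr_inr (a b : Fin n) : ¬ Gr.graph.Adj (Sum.inr a) (Sum.inr b) := by
  intro h
  have := Gr.bipartite.mem_of_mem_adj' ⟨b, rfl⟩ h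
  simp at this

open Classical in
theorem card_neighbors_inl (a : Fin n) :
    (Finset.univ.filter fun b => Gr.graph.Adj (Sum.inl a) (Sum.inr b)).card = Δ := by
  refine Eq.trans ?_ (Gr.regular (Sum.inl a))
  rw [← Set.ncard_coe_finset]
  refine Set.ncard_congr (fun b _ => Sum.inr b) ?_ ?_ ?_
  · intro b hb; simpa using hb
  · intro b c _ _ h; simpa using h
  · rintro (b | b) hb
    · exact absurd hb (Gr.not_adj_inl_inl a b)
    · exact ⟨b, by simpa using hb, rfl⟩

open Classical in
theorem card_neighbors_inr (b : Fin n) :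
    (Finset.univ.filter fun a => Gr.graph.Adj (Sum.inl a) (Sum.inr b)).card = Δ := by
  refine Eq.trans ?_ (Gr.regular (Sum.inr b))
  rw [← Set.ncard_coe_finset]
  refine Set.ncard_congr (fun a _ => Sum.inl a) ?_ ?_ ?_
  · intro a ha; simpa using (by simpa using ha : Gr.graph.Adj _ _).symm
  · intro a c _ _ h; simpa using h
  · rintro (a | a) ha
    · exact ⟨a, by simpa using (show Gr.graph.Adj _ _ from ha).symm, rfl⟩
    · exact absurd ha (Gr.not_adj_inr_inr b a)

open Classical in
/-- The adjacency matrix minus its expected value. -/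
def deflated : Matrix (Fin n ⊕ Fin n) (Fin n ⊕ Fin n) ℝ :=
  Gr.graph.adjMatrix ℝ - fromBlocks 0 (of fun _ _ => (Δ : ℝ) / n) (of fun _ _ => (Δ : ℝ) / n) 0

theorem deflated_isHermitian : Gr.deflated.IsHermitian := by
  classical
  refine IsHermitian.sub ?_ ?_
  · rw [IsHermitian, conjTranspose_eq_transpose_of_trivial, SimpleGraph.transpose_adjMatrix]
  · ext i j
    rcases i with i | i <;> rcases j with j | j <;> simp

open Classical in
theorem adjMatrix_mulVec_inl (x : Fin n ⊕ Fin n → ℝ) (a : Fin n) :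
    (Gr.graph.adjMatrix ℝ *ᵥ x) (Sum.inl a) =
      ∑ b, if Gr.graph.Adj (Sum.inl a) (Sum.inr b) then x (Sum.inr b) else 0 := by
  simp [mulVec, dotProduct, Fintype.sum_sum_type, SimpleGraph.adjMatrix_apply, Gr.not_adj_inl_inl]

open Classical in
theorem adjMatrix_mulVec_inr (x : Fin n ⊕ Fin n → ℝ) (b : Fin n) :
    (Gr.graph.adjMatrix ℝ *ᵥ x) (Sum.inr b) =
      ∑ a, if Gr.graph.Adj (Sum.inl a) (Sum.inr b) then x (Sum.inl a) else 0 := by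
  simp [mulVec, dotProduct, Fintype.sum_sum_type, SimpleGraph.adjMatrix_apply, Gr.not_adj_inr_inr,
    Gr.graph.adj_comm (Sum.inr b)]

open Classical in
theorem deflated_mulVec_inl (x : Fin n ⊕ Fin n → ℝ) (a : Fin n) :
    (Gr.deflated *ᵥ x) (Sum.inl a) =
      (∑ b, if Gr.graph.Adj (Sum.inl a) (Sum.inr b) then x (Sum.inr b) else 0)
        - Δ / n * ∑ b, x (Sum.inr b) := by
  rw [deflated, sub_mulVec, Pi.sub_apply, adjMatrix_mulVec_inl, fromBlocks_mulVec]
  simp [mulVec, dotProduct, Finset.mul_sum]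

open Classical in
theorem deflated_mulVec_inr (x : Fin n ⊕ Fin n → ℝ) (b : Fin n) :
    (Gr.deflated *ᵥ x) (Sum.inr b) =
      (∑ a, if Gr.graph.Adj (Sum.inl a) (Sum.inr b) then x (Sum.inl a) else 0)
        - Δ / n * ∑ a, x (Sum.inl a) := by
  rw [deflated, sub_mulVec, Pi.sub_apply, adjMatrix_mulVec_inr, fromBlocks_mulVec]
  simp [mulVec, dotProduct, Finset.mul_sum]

theorem deflated_mulVec_elim (hn : 1 ≤ n) (p q : ℝ) :
    Gr.deflated *ᵥ (Sum.elim (fun _ => p) fun _ => q) = 0 := by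
  classical
  have hn' : (n : ℝ) ≠ 0 := by positivity
  ext (a | b)
  · rw [deflated_mulVec_inl]
    simp only [Sum.elim_inr, ← Finset.sum_filter, Finset.sum_const, Gr.card_neighbors_inl a]
    simp; field_simp; simp
  · rw [deflated_mulVec_inr]
    simp only [Sum.elim_inl, ← Finset.sum_filter, Finset.sum_const, Gr.card_neighbors_inr b]
    simp; field_simp; simp

open Classical in
theorem adjMatrix_mulVec_elim (p q : ℝ) :
    Gr.graph.adjMatrix ℝ *ᵥ (Sum.elim (fun _ => p) fun _ => q) =
      Sum.elim (fun _ => Δ * q) fun _ => Δ * p := by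
  ext (a | b)
  · rw [adjMatrix_mulVec_inl]
    simp only [Sum.elim_inr, ← Finset.sum_filter, Finset.sum_const, Gr.card_neighbors_inl a]
    simp
  · rw [adjMatrix_mulVec_inr]
    simp only [Sum.elim_inl, ← Finset.sum_filter, Finset.sum_const, Gr.card_neighbors_inr b]
    simp

/-- The matrix `deflated` kills every vector that is constant on each side. Its eigenvectors for μ ≠
0 are orthogonal to those vectors, hence are eigenvectors of the adjacency matrix itself. If μ = ±Δ,
the trivial eigenvector is a second, independent one, so μ survives the removal of one copy. -/
theorem abs_eigenvalue_deflated_le (hn : 1 ≤ n) {γ : ℝ} (hγ : Gr.IsSpectralExpander γ) {μ : ℝ}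
    {x : Fin n ⊕ Fin n → ℝ} (hx : x ≠ 0) (h : Gr.deflated *ᵥ x = μ • x) : |μ| ≤ Δ * γ := by
  classical
  obtain ⟨h0, -, hsp⟩ := hγ
  rcases eq_or_ne μ 0 with rfl | hμ
  · simpa using by positivity
  have horth : ∀ p q : ℝ, (Sum.elim (fun _ => p) fun _ => q) ⬝ᵥ x = 0 := by
    intro p q
    have h1 : (Sum.elim (fun _ => p) fun _ => q) ⬝ᵥ Gr.deflated *ᵥ x = 0 := by
      have ht : Gr.deflatedᵀ = Gr.deflated :=
        (conjTranspose_eq_transpose_of_trivial _).symm.trans Gr.deflated_isHermitian.eq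
      rw [dotProduct_mulVec, ← mulVec_transpose, ht, Gr.deflated_mulVec_elim hn, zero_dotProduct]
    rw [h, dotProduct_smul, smul_eq_mul] at h1
    exact (mul_eq_zero.1 h1).resolve_left hμ
  have hl : ∑ a, x (Sum.inl a) = 0 := by
    simpa [dotProduct, Fintype.sum_sum_type] using horth 1 0
  have hr : ∑ a, x (Sum.inr a) = 0 := by
    simpa [dotProduct, Fintype.sum_sum_type] using horth 0 1
  have hA : Gr.graph.adjMatrix ℝ *ᵥ x = μ • x := by
    rw [← h]
    ext (a | b)
    · rw [deflated_mulVec_inl, adjMatrix_mulVec_inl, hr]; simp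
    · rw [deflated_mulVec_inr, adjMatrix_mulVec_inr, hl]; simp
  have hone : 1 ≤ (Gr.graph.adjMatrix ℝ).charpoly.roots.count μ := by
    have hli : LinearIndependent ℝ ![x] := LinearIndependent.of_subsingleton 0 (by simpa using hx)
    simpa using card_le_count_roots_charpoly hli (A := Gr.graph.adjMatrix ℝ) (μ := μ)
      (fun i => by fin_cases i; simpa using hA)
  have htwo : ∀ p q : ℝ, p ≠ 0 → Δ * q = μ * p → Δ * p = μ * q →
      2 ≤ (Gr.graph.adjMatrix ℝ).charpoly.roots.count μ := by
    intro p q hp h1 h2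
    have hne : (Sum.elim (fun _ => p) fun _ => q : Fin n ⊕ Fin n → ℝ) ≠ 0 := fun h =>
      hp (congrFun h (Sum.inl ⟨0, hn⟩))
    have hli := linearIndependent_pair_of_dotProduct_eq_zero hne hx (horth p q)
    have := card_le_count_roots_charpoly hli (A := Gr.graph.adjMatrix ℝ) (μ := μ) (fun i => by
      fin_cases i
      · simp only [Fin.zero_eta, cons_val_zero]
        rw [adjMatrix_mulVec_elim, h1, h2]
        ext (a | b) <;> simp
      · simpa using hA)
    simpa using this
  apply hsp
  rw [← Multiset.count_pos]
  -- The values Δ and -Δ coincide only for Δ = 0, which μ ≠ 0 excludes here; hence at most one of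
  -- the two erasures affects μ.
  by_cases h1 : μ = Δ
  · have hne : μ ≠ -(Δ : ℝ) := by
      intro h2; apply hμ; linarith
    rw [Multiset.count_erase_of_ne hne, h1, Multiset.count_erase_self, ← h1]
    have := htwo 1 1 one_ne_zero (by rw [h1]) (by rw [h1])
    omega
  · by_cases h2 : μ = -Δ
    · rw [h2, Multiset.count_erase_self, Multiset.count_erase_of_ne (by rw [← h2]; exact h1), ← h2]
      have := htwo 1 (-1) one_ne_zero (by rw [h2]; ring) (by rw [h2]; ring)
      omega
    · rw [Multiset.count_erase_of_ne h2, Multiset.count_erase_of_ne h1]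
      omega

open Classical in
/-- The number of edges between a set `T` of left vertices and a set `S` of right vertices. -/
def edgeCount (T S : Finset (Fin n)) : ℕ :=
  ∑ b ∈ S, (T.filter fun a => Gr.graph.Adj (Sum.inl a) (Sum.inr b)).card

/-- Expander mixing: the spectral bound for `deflated` is evaluated at the indicator vectors of S
and T. The subtracted constant blocks contribute the main term Δ|S||T|/n. -/
theorem edgeCount_le (hn : 1 ≤ n) {γ : ℝ} (hγ : Gr.IsSpectralExpander γ) (T S : Finset (Fin n)) :
    (Gr.edgeCount T S : ℝ) ≤ Δ * (S.card * T.card / n + γ * (√S.card * √T.card)) := by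
  classical
  set x : Fin n ⊕ Fin n → ℝ := Sum.elim 0 fun b => if b ∈ S then 1 else 0 with hx
  set y : Fin n ⊕ Fin n → ℝ := Sum.elim (fun a => if a ∈ T then 1 else 0) 0 with hy
  have hb := abs_dotProduct_mulVec_le Gr.deflated_isHermitian
    (mul_nonneg (Nat.cast_nonneg Δ) hγ.1)
    (fun μ x hx h => Gr.abs_eigenvalue_deflated_le hn hγ hx h) x y
  have hxx : x ⬝ᵥ x = S.card := by simp [hx, dotProduct, Fintype.sum_sum_type]
  have hyy : y ⬝ᵥ y = T.card := by simp [hy, dotProduct, Fintype.sum_sum_type]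
  have hxy : x ⬝ᵥ Gr.deflated *ᵥ y = Gr.edgeCount T S - Δ * (S.card * T.card / n) := by
    simp only [dotProduct, Fintype.sum_sum_type, deflated_mulVec_inr]
    simp only [hx, hy, Sum.elim_inl, Sum.elim_inr, Pi.zero_apply, zero_mul, Finset.sum_const_zero,
      zero_add, ite_mul, one_mul, Finset.sum_ite_mem, Finset.univ_inter, Finset.sum_sub_distrib,
      Finset.sum_const, edgeCount]
    push_cast
    congr 1
    · refine Finset.sum_congr rfl fun b _ => ?_
      rw [← Finset.sum_filter, Finset.sum_ite_mem]
      simp only [Finset.sum_const, nsmul_eq_mul, mul_one]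
      congr 2
      ext; simp [and_comm]
    · simp; ring
  rw [hxx, hyy, hxy] at hb
  have := (abs_le.1 hb).2
  linarith

end BipartiteGraph

end Mixing

/-! ### Subwords at the vertices of a bipartite graph -/

namespace BipartiteGraph

variable {n Δ : ℕ} (Gr : BipartiteGraph n Δ) {F : Type u} [Field F]

theorem mem_incident {w : Fin n ⊕ Fin n} {e : Gr.Edge} : e ∈ Gr.incident w ↔ w ∈ e.1 := by
  simp [incident]

theorem exists_ends (e : Gr.Edge) : ∃ a b, e.1 = s(Sum.inl a, Sum.inr b) := by
  obtain ⟨e, he⟩ := e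
  induction e using Sym2.ind with
  | _ p q =>
    rcases p with a | a <;> rcases q with b | b
    · exact absurd he (Gr.not_adj_inl_inl a b)
    · exact ⟨a, b, rfl⟩
    · exact ⟨b, a, Sym2.eq_swap⟩
    · exact absurd he (Gr.not_adj_inr_inr a b)

/-- The edge between two adjacent vertices. -/
def mkEdge {a b : Fin n} (h : Gr.graph.Adj (Sum.inl a) (Sum.inr b)) : Gr.Edge :=
  ⟨s(Sum.inl a, Sum.inr b), h⟩

open Classical in
/-- The value of a word on the edge between `u_a` and `v_b`, and `0` if there is no such edge. -/
def edgeValue (x : Gr.Edge → F) (a b : Fin n) : F :=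
  if h : Gr.graph.Adj (Sum.inl a) (Sum.inr b) then x (Gr.mkEdge h) else 0

theorem adj_of_edgeValue_ne_zero {x : Gr.Edge → F} {a b : Fin n} (h : Gr.edgeValue x a b ≠ 0) :
    Gr.graph.Adj (Sum.inl a) (Sum.inr b) := by
  by_contra h'
  simp [edgeValue, h'] at h

theorem edgeValue_of_eq {x : Gr.Edge → F} {a b : Fin n} {e : Gr.Edge}
    (h : e.1 = s(Sum.inl a, Sum.inr b)) : Gr.edgeValue x a b = x e := by
  have hadj : Gr.graph.Adj (Sum.inl a) (Sum.inr b) := by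
    rw [← SimpleGraph.mem_edgeSet, ← h]; exact e.2
  rw [edgeValue, dif_pos hadj]
  exact congrArg x (Subtype.ext h.symm)

open Classical in
theorem hammingNorm_subword (w : Fin n ⊕ Fin n) (x : Gr.Edge → F) :
    hammingNorm (Gr.subword w x) = ((Gr.incident w).filter fun e => x e ≠ 0).card := by
  refine Finset.card_bij (fun i _ => (Gr.incident w).orderEmbOfFin (Gr.card_incident w) i) ?_ ?_ ?_
  · intro i hi
    exact Finset.mem_filter.2 ⟨Finset.orderEmbOfFin_mem _ _ _, (Finset.mem_filter.1 hi).2⟩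
  · intro i _ j _ h
    exact ((Gr.incident w).orderEmbOfFin (Gr.card_incident w)).injective h
  · intro e he
    obtain ⟨h1, h2⟩ := Finset.mem_filter.1 he
    have : e ∈ Set.range ((Gr.incident w).orderEmbOfFin (Gr.card_incident w)) := by
      rw [Finset.range_orderEmbOfFin]; exact h1
    obtain ⟨i, rfl⟩ := this
    exact ⟨i, Finset.mem_filter.2 ⟨Finset.mem_univ _, h2⟩, rfl⟩

open Classical in
theorem hammingNorm_subword_inr (b : Fin n) (x : Gr.Edge → F) :
    hammingNorm (Gr.subword (Sum.inr b) x) =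
      (Finset.univ.filter fun a => Gr.edgeValue x a b ≠ 0).card := by
  rw [hammingNorm_subword]
  symm
  refine Finset.card_bij (fun a ha => Gr.mkEdge
    (Gr.adj_of_edgeValue_ne_zero (Finset.mem_filter.1 ha).2)) ?_ ?_ ?_
  · intro a ha
    refine Finset.mem_filter.2 ⟨Gr.mem_incident.2 (Sym2.mem_mk_right _ _), ?_⟩
    have h := (Finset.mem_filter.1 ha).2
    rwa [Gr.edgeValue_of_eq (e := Gr.mkEdge (Gr.adj_of_edgeValue_ne_zero h)) rfl] at h
  · intro a _ a' _ h
    have h : s(Sum.inl _, Sum.inr _) = s(Sum.inl _, Sum.inr _) := congrArg Subtype.val h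
    simpa using h
  · intro e he
    obtain ⟨h1, h2⟩ := Finset.mem_filter.1 he
    obtain ⟨a, b', hab⟩ := Gr.exists_ends e
    rw [mem_incident, hab] at h1
    obtain rfl : b = b' := by simpa using h1
    refine ⟨a, Finset.mem_filter.2 ⟨Finset.mem_univ _, ?_⟩, Subtype.ext hab.symm⟩
    rwa [Gr.edgeValue_of_eq hab]

open Classical in
theorem hammingNorm_subword_inl (a : Fin n) (x : Gr.Edge → F) :
    hammingNorm (Gr.subword (Sum.inl a) x) =
      (Finset.univ.filter fun b => Gr.edgeValue x a b ≠ 0).card := by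
  rw [hammingNorm_subword]
  symm
  refine Finset.card_bij (fun b hb => Gr.mkEdge
    (Gr.adj_of_edgeValue_ne_zero (Finset.mem_filter.1 hb).2)) ?_ ?_ ?_
  · intro b hb
    refine Finset.mem_filter.2 ⟨Gr.mem_incident.2 (Sym2.mem_mk_left _ _), ?_⟩
    have h := (Finset.mem_filter.1 hb).2
    rwa [Gr.edgeValue_of_eq (e := Gr.mkEdge (Gr.adj_of_edgeValue_ne_zero h)) rfl] at h
  · intro b _ b' _ h
    have h : s(Sum.inl _, Sum.inr _) = s(Sum.inl _, Sum.inr _) := congrArg Subtype.val h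
    simpa using h
  · intro e he
    obtain ⟨h1, h2⟩ := Finset.mem_filter.1 he
    obtain ⟨a', b, hab⟩ := Gr.exists_ends e
    rw [mem_incident, hab] at h1
    obtain rfl : a = a' := by simpa using h1
    refine ⟨b, Finset.mem_filter.2 ⟨Finset.mem_univ _, ?_⟩, Subtype.ext hab.symm⟩
    rwa [Gr.edgeValue_of_eq hab]

theorem subword_inr_ne_zero {x : Gr.Edge → F} {a b : Fin n} (h : Gr.edgeValue x a b ≠ 0) :
    Gr.subword (Sum.inr b) x ≠ 0 := by
  classical
  rw [← hammingNorm_pos_iff, hammingNorm_subword_inr]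
  exact Finset.card_pos.2 ⟨a, by simpa using h⟩

theorem subword_inl_ne_zero {x : Gr.Edge → F} {a b : Fin n} (h : Gr.edgeValue x a b ≠ 0) :
    Gr.subword (Sum.inl a) x ≠ 0 := by
  classical
  rw [← hammingNorm_pos_iff, hammingNorm_subword_inl]
  exact Finset.card_pos.2 ⟨b, by simpa using h⟩

open Classical in
/-- The left vertices whose subword is nonzero. -/
def leftSupport (x : Gr.Edge → F) : Finset (Fin n) :=
  Finset.univ.filter fun a => Gr.subword (Sum.inl a) x ≠ 0

open Classical in
/-- The right vertices whose subword is nonzero. -/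
def rightSupport (x : Gr.Edge → F) : Finset (Fin n) :=
  Finset.univ.filter fun b => Gr.subword (Sum.inr b) x ≠ 0

open Classical in
-- A nonzero symbol on an edge makes the subwords at both of its ends nonzero, so every symbol
-- counted from S lies on an edge into the left support.
theorem sum_hammingNorm_subword_inr_le (x : Gr.Edge → F) (S : Finset (Fin n)) :
    ∑ b ∈ S, hammingNorm (Gr.subword (Sum.inr b) x) ≤ Gr.edgeCount (Gr.leftSupport x) S := by
  refine Finset.sum_le_sum fun b _ => ?_
  rw [hammingNorm_subword_inr]
  refine Finset.card_le_card fun a ha => ?_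
  have ha := (Finset.mem_filter.1 ha).2
  exact Finset.mem_filter.2 ⟨Finset.mem_filter.2 ⟨Finset.mem_univ _, Gr.subword_inl_ne_zero ha⟩,
    Gr.adj_of_edgeValue_ne_zero ha⟩

open Classical in
theorem sum_hammingNorm_subword_inl_le (x : Gr.Edge → F) (T : Finset (Fin n)) :
    ∑ a ∈ T, hammingNorm (Gr.subword (Sum.inl a) x) ≤ Gr.edgeCount T (Gr.rightSupport x) := by
  have h : Gr.edgeCount T (Gr.rightSupport x) = ∑ a ∈ T,
      ((Gr.rightSupport x).filter fun b => Gr.graph.Adj (Sum.inl a) (Sum.inr b)).card :=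
    (Finset.sum_card_bipartiteAbove_eq_sum_card_bipartiteBelow
      (fun a b => Gr.graph.Adj (Sum.inl a) (Sum.inr b))).symm
  rw [h]
  refine Finset.sum_le_sum fun a _ => ?_
  rw [hammingNorm_subword_inl]
  refine Finset.card_le_card fun b hb => ?_
  have hb := (Finset.mem_filter.1 hb).2
  exact Finset.mem_filter.2 ⟨Finset.mem_filter.2 ⟨Finset.mem_univ _, Gr.subword_inr_ne_zero hb⟩,
    Gr.adj_of_edgeValue_ne_zero hb⟩

theorem exists_edgeValue_ne_zero {x : Gr.Edge → F} (h : x ≠ 0) :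
    ∃ a b, Gr.edgeValue x a b ≠ 0 := by
  obtain ⟨e, he⟩ := Function.ne_iff.1 h
  obtain ⟨a, b, hab⟩ := Gr.exists_ends e
  exact ⟨a, b, by rwa [Gr.edgeValue_of_eq hab]⟩

theorem leftSupport_nonempty {x : Gr.Edge → F} (h : x ≠ 0) : (Gr.leftSupport x).Nonempty := by
  obtain ⟨a, b, hab⟩ := Gr.exists_edgeValue_ne_zero h
  exact ⟨a, by simpa [leftSupport] using Gr.subword_inl_ne_zero hab⟩

theorem rightSupport_nonempty {x : Gr.Edge → F} (h : x ≠ 0) : (Gr.rightSupport x).Nonempty := by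
  obtain ⟨a, b, hab⟩ := Gr.exists_edgeValue_ne_zero h
  exact ⟨b, by simpa [rightSupport] using Gr.subword_inr_ne_zero hab⟩

theorem eq_zero_of_subword_inr {x : Gr.Edge → F} (h : ∀ b, Gr.subword (Sum.inr b) x = 0) :
    x = 0 := by
  by_contra hx
  obtain ⟨a, b, hab⟩ := Gr.exists_edgeValue_ne_zero hx
  exact Gr.subword_inr_ne_zero hab (h b)

theorem card_edge : Fintype.card Gr.Edge = n * Δ := by
  classical
  have h1 : (Finset.univ : Finset Gr.Edge) =
      Finset.univ.biUnion fun b : Fin n => Gr.incident (Sum.inr b) := by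
    ext e
    obtain ⟨a, b, hab⟩ := Gr.exists_ends e
    simp only [Finset.mem_univ, Finset.mem_biUnion, true_and, true_iff]
    exact ⟨b, Gr.mem_incident.2 (by rw [hab]; exact Sym2.mem_mk_right _ _)⟩
  rw [← Finset.card_univ, h1, Finset.card_biUnion]
  · simp [Gr.card_incident]
  · intro b _ b' _ hbb
    refine Finset.disjoint_left.2 fun e he he' => hbb ?_
    obtain ⟨a, c, hac⟩ := Gr.exists_ends e
    rw [mem_incident, hac] at he he'
    have h2 : b = c := by simpa using he
    have h3 : b' = c := by simpa using he'
    rw [h2, h3]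

/-- Restriction to the edges at a vertex, as a linear map. -/
def subwordHom (F : Type u) [Field F] (w : Fin n ⊕ Fin n) : (Gr.Edge → F) →ₗ[F] (Fin Δ → F) where
  toFun := Gr.subword w
  map_add' _ _ := rfl
  map_smul' _ _ := rfl

end BipartiteGraph

/-! ### Column distances of convolutional codes -/

section ColumnDistance

theorem dotProduct_eq_zero_of_mem_span {F ι : Type*} [Field F] [Fintype ι] {z : ι → F}
    {S : Set (ι → F)} (h : ∀ v ∈ S, z ⬝ᵥ v = 0) {v : ι → F} (hv : v ∈ Submodule.span F S) :
    z ⬝ᵥ v = 0 := by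
  induction hv using Submodule.span_induction with
  | mem x hx => exact h x hx
  | zero => simp
  | add x y _ _ hx hy => rw [dotProduct_add, hx, hy, add_zero]
  | smul a x _ hx => rw [dotProduct_smul, hx, smul_zero]

theorem eq_zero_of_span_eq_top {F ι : Type*} [Field F] [Fintype ι] {z : ι → F}
    {S : Set (ι → F)} (hS : Submodule.span F S = ⊤) (h : ∀ v ∈ S, z ⬝ᵥ v = 0) : z = 0 := by
  classical
  ext i
  have := dotProduct_eq_zero_of_mem_span h (v := Pi.single i 1) (by rw [hS]; trivial)
  simpa using this

theorem span_col_eq_top {F : Type u} [Field F] {k n : ℕ} {A : Matrix (Fin k) (Fin n) F}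
    (hA : A.rank = k) : Submodule.span F (Set.range A.col) = ⊤ := by
  apply Submodule.eq_top_of_finrank_eq
  rw [← rank_eq_finrank_span_cols, hA]
  simp

theorem eq_zero_of_vecMul_eq_zero {F : Type u} [Field F] {k n : ℕ} {A : Matrix (Fin k) (Fin n) F}
    (hA : A.rank = k) {z : Fin k → F} (hz : z ᵥ* A = 0) : z = 0 := by
  refine eq_zero_of_span_eq_top (span_col_eq_top hA) ?_
  rintro _ ⟨j, rfl⟩
  exact congrFun hz j

open Classical in
/-- Every word is within distance `n - k` of a code of full dimension `k`. -/
theorem exists_hammingNorm_add_vecMul_le {F : Type u} [Field F] {k n : ℕ}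
    {A : Matrix (Fin k) (Fin n) F} (hA : A.rank = k) (w : Fin n → F) :
    ∃ z : Fin k → F, hammingNorm (w + z ᵥ* A) ≤ n - k := by
  -- An information set: k positions whose columns form a basis. The multiplier z is then chosen to
  -- cancel w on these positions, leaving at most n - k nonzero entries.
  obtain ⟨κ, a, ha, hsp, hli⟩ := exists_linearIndependent' F A.col
  rw [span_col_eq_top hA] at hsp
  have : Fintype κ := Fintype.ofInjective a ha
  have hcard : Fintype.card κ = k := by
    have h1 := linearIndependent_iff_card_eq_finrank_span.1 hli
    rw [Set.finrank, hsp] at h1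
    simpa using h1
  let f : (Fin k → F) →ₗ[F] (κ → F) := (LinearMap.funLeft F F a) ∘ₗ A.vecMulLinear
  have hf : Function.Injective f := by
    rw [injective_iff_map_eq_zero]
    intro z hz
    refine eq_zero_of_span_eq_top hsp ?_
    rintro _ ⟨i, rfl⟩
    exact congrFun hz i
  have hfs : Function.Surjective f :=
    (LinearMap.injective_iff_surjective_of_finrank_eq_finrank (by simp [hcard])).1 hf
  obtain ⟨z, hz⟩ := hfs fun i => -w (a i)
  refine ⟨z, ?_⟩
  have hsub : (Finset.univ.filter fun i => (w + z ᵥ* A) i ≠ 0) ⊆ (Finset.univ.image a)ᶜ := by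
    intro j hj
    rw [Finset.mem_compl]
    intro hj'
    obtain ⟨i, -, rfl⟩ := Finset.mem_image.1 hj'
    apply (Finset.mem_filter.1 hj).2
    have : (z ᵥ* A) (a i) = -w (a i) := congrFun hz i
    rw [Pi.add_apply, this, add_neg_cancel]
  have := Finset.card_le_card hsub
  rwa [Finset.card_compl, Finset.card_image_of_injective _ ha, Finset.card_univ, hcard,
    Fintype.card_fin] at this

variable {F : Type u} [Field F] {k n : ℕ}

/-- The code block at time `t` for the input sequence `a`. -/
def encode (G : Matrix (Fin k) (Fin n) F[X]) (a : ℕ → Fin k → F) (t : ℕ) : Fin n → F :=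
  ∑ p ∈ Finset.HasAntidiagonal.antidiagonal t, a p.2 ᵥ* coeffMatrix G p.1

theorem encode_zero (G : Matrix (Fin k) (Fin n) F[X]) (a : ℕ → Fin k → F) :
    encode G a 0 = a 0 ᵥ* coeffMatrix G 0 := by
  simp [encode]

theorem encode_congr (G : Matrix (Fin k) (Fin n) F[X]) {a a' : ℕ → Fin k → F} {t : ℕ}
    (h : ∀ s ≤ t, a s = a' s) : encode G a t = encode G a' t :=
  Finset.sum_congr rfl fun p hp => by
    rw [h p.2 (Finset.HasAntidiagonal.antidiagonal.snd_le hp)]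

theorem encode_add (G : Matrix (Fin k) (Fin n) F[X]) (a a' : ℕ → Fin k → F) (t : ℕ) :
    encode G (a + a') t = encode G a t + encode G a' t := by
  simp [encode, add_vecMul, Finset.sum_add_distrib]

theorem encode_single (G : Matrix (Fin k) (Fin n) F[X]) (t : ℕ) (z : Fin k → F) :
    encode G (Pi.single t z) t = z ᵥ* coeffMatrix G 0 := by
  rw [encode, Finset.sum_eq_single (0, t)]
  · simp
  · rintro ⟨i, j⟩ hp hne
    rw [Finset.HasAntidiagonal.mem_antidiagonal] at hp
    have : j ≠ t := by
      rintro rfl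
      exact hne (by simp at hp; simp [hp])
    rw [Pi.single_eq_of_ne this, zero_vecMul]
  · intro h
    exact absurd (Finset.HasAntidiagonal.mem_antidiagonal.2 (zero_add t)) h

theorem block_vecMul (G : Matrix (Fin k) (Fin n) F[X]) (x : Fin k → F[X]) (t : ℕ) :
    block (x ᵥ* G) t = encode G (fun s i => (x i).coeff s) t := by
  ext e
  simp only [block, encode, vecMul, dotProduct, finsetSum_coeff, coeff_mul, coeffMatrix,
    Finset.sum_apply, map_apply]
  rw [Finset.sum_comm]
  refine Finset.sum_equiv (Equiv.prodComm ℕ ℕ) (fun p => ?_) (fun p _ => rfl)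
  simp [add_comm]

open Classical in
/-- A code with the maximum distance profile has optimal column distances at all earlier times,
for semi-infinite codewords. -/
theorem le_sum_hammingNorm_encode {C : Submodule F[X] (Fin n → F[X])}
    {G : Matrix (Fin k) (Fin n) F[X]} (hC : IsMDP k C) (hG : IsGeneratorMatrix C G)
    (h0 : (coeffMatrix G 0).rank = k) {j : ℕ} (hj : j ≤ profileLength k C)
    {a : ℕ → Fin k → F} (ha : a 0 ≠ 0) :
    (n - k) * (j + 1) + 1 ≤ ∑ t ∈ Finset.range (j + 1), hammingNorm (encode G a t) := by
  induction hj using Nat.decreasingInduction generalizing a with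
  | self =>
    set L := profileLength k C
    -- The definition of the column distance concerns polynomial codewords; truncating the input
    -- after time L leaves the blocks up to time L unchanged.
    let x : Fin k → F[X] := fun i => ∑ s ∈ Finset.range (L + 1), monomial s (a s i)
    have hx : ∀ t ≤ L, block (x ᵥ* G) t = encode G a t := by
      intro t ht
      rw [block_vecMul]
      refine encode_congr G fun s hs => ?_
      ext i
      simp only [x, finsetSum_coeff, coeff_monomial]
      rw [Finset.sum_ite_eq' (Finset.range (L + 1)) s, if_pos (Finset.mem_range.2 (by omega))]
    have hmem : x ᵥ* G ∈ C := by
      have : x ᵥ* G ∈ (C : Set (Fin n → F[X])) := by rw [hG]; exact ⟨x, rfl⟩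
      exact this
    have hne : block (x ᵥ* G) 0 ≠ 0 := by
      rw [hx 0 (Nat.zero_le _), encode_zero]
      exact fun h => ha (eq_zero_of_vecMul_eq_zero h0 h)
    have h1 : convColumnDist C L ≤
        ((∑ t ∈ Finset.range (L + 1), hammingNorm (block (x ᵥ* G) t) : ℕ) : ℕ∞) :=
      iInf₂_le_of_le _ hmem (iInf_le_of_le hne le_rfl)
    rw [hC, Nat.cast_le] at h1
    refine h1.trans_eq (Finset.sum_congr rfl fun t ht => ?_)
    rw [hx t (Nat.lt_succ_iff.1 (Finset.mem_range.1 ht))]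
  | of_succ j hj ih =>
    -- Changing the input at time j + 1 does not touch earlier blocks but can lower the weight of
    -- the last one to n - k. The bound for j + 1 then drops by at most n - k, which is the bound
    -- for j.
    obtain ⟨z, hz⟩ := exists_hammingNorm_add_vecMul_le h0 (encode G a (j + 1))
    have h1 := ih (a := a + Pi.single (j + 1) z) (by simpa using ha)
    rw [Finset.sum_range_succ, encode_add, encode_single] at h1
    have h2 : ∑ t ∈ Finset.range (j + 1), hammingNorm (encode G (a + Pi.single (j + 1) z) t) =
        ∑ t ∈ Finset.range (j + 1), hammingNorm (encode G a t) := by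
      refine Finset.sum_congr rfl fun t ht => ?_
      rw [encode_congr G (a' := a)]
      intro s hs
      have : s ≠ j + 1 := by have := Finset.mem_range.1 ht; omega
      simp [this]
    rw [h2] at h1
    have h3 : (n - k) * (j + 1 + 1) = (n - k) * (j + 1) + (n - k) := by ring
    omega

/-- The Cauchy product with finitely many coefficients, as a sum over `Fin`. -/
theorem sum_fin_eq_sum_antidiagonal {M : Type*} [AddCommMonoid M] {m : ℕ} (f : ℕ → ℕ → M)
    (hf : ∀ i s, m < i → f i s = 0) (t : ℕ) :
    (∑ i : Fin (m + 1), if (i : ℕ) ≤ t then f i (t - i) else 0) =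
      ∑ p ∈ Finset.HasAntidiagonal.antidiagonal t, f p.1 p.2 := by
  rw [Finset.Nat.sum_antidiagonal_eq_sum_range_succ f t,
    Fin.sum_univ_eq_sum_range (fun i => if i ≤ t then f i (t - i) else 0), ← Finset.sum_filter]
  refine Finset.sum_subset_zero_on_sdiff (fun i hi => ?_) (fun i hi => ?_) (fun _ _ => rfl)
  · simp at hi ⊢; omega
  · simp at hi
    exact hf _ _ (by omega)

theorem coeffMatrix_eq_zero {G : Matrix (Fin k) (Fin n) F[X]} {j : ℕ} (h : memory G < j) :
    coeffMatrix G j = 0 := by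
  ext i e
  refine coeff_eq_zero_of_natDegree_lt (lt_of_le_of_lt ?_ h)
  exact (Finset.le_sup (f := fun e => (G i e).natDegree) (Finset.mem_univ e)).trans
    (Finset.le_sup (f := rowDegree G) (Finset.mem_univ i))

theorem encode_eq_sum_fin {m : ℕ} {G : Matrix (Fin k) (Fin n) F[X]} (hm : memory G = m)
    (a : ℕ → Fin k → F) (t : ℕ) :
    encode G a t =
      ∑ i : Fin (m + 1), if (i : ℕ) ≤ t then a (t - i) ᵥ* coeffMatrix G i else 0 := by
  refine (sum_fin_eq_sum_antidiagonal (fun i s => a s ᵥ* coeffMatrix G i) ?_ t).symm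
  intro i s hi
  rw [coeffMatrix_eq_zero (hm ▸ hi), vecMul_zero]

end ColumnDistance

/-! ### The block codes of the construction -/

section Blocks

variable {F : Type u} [Field F] {k n Δ m kt : ℕ}

theorem mem_codeB1 {G : Matrix (Fin k) (Fin Δ) F[X]} {c : Fin (m + 1) → Fin Δ → F} :
    c ∈ codeB1 m G ↔ ∃ a : Fin k → F, ∀ j, c j = a ᵥ* coeffMatrix G j := by
  rw [codeB1, Submodule.mem_span_range_iff_exists_fun]
  refine exists_congr fun a => ⟨?_, fun h => ?_⟩
  · rintro rfl j
    ext e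
    simp [vecMul, dotProduct]
  · ext j e
    rw [h j]
    simp [vecMul, dotProduct]

theorem finrank_codeB1 {G : Matrix (Fin k) (Fin Δ) F[X]} (h0 : (coeffMatrix G 0).rank = k) :
    Module.finrank F (codeB1 m G) = k := by
  have hli : LinearIndependent F
      (fun (i : Fin k) (j : Fin (m + 1)) => coeffMatrix G j i) := by
    rw [Fintype.linearIndependent_iff]
    intro g hg
    have : g ᵥ* coeffMatrix G 0 = 0 := by
      ext e
      simpa [vecMul, dotProduct] using congrFun (congrFun hg 0) e
    exact congrFun (eq_zero_of_vecMul_eq_zero h0 this)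
  rw [codeB1, finrank_span_eq_card hli, Fintype.card_fin]

variable (Gr : BipartiteGraph n Δ)

/-- A word is determined by its restrictions to the right vertices, and each of these n restrictions
lies in a code of dimension k. -/
theorem finrank_codeB_le {G : Matrix (Fin k) (Fin Δ) F[X]} (h0 : (coeffMatrix G 0).rank = k)
    (B2 : Submodule F (Fin Δ → F)) : Module.finrank F (codeB m Gr G B2) ≤ n * k := by
  let f : codeB m Gr G B2 →ₗ[F] (Fin n → codeB1 m G) :=
    { toFun := fun c s => ⟨_, c.2.1 s⟩
      map_add' := fun _ _ => rfl
      map_smul' := fun _ _ => rfl }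
  have hf : Function.Injective f := by
    rw [injective_iff_map_eq_zero]
    intro c hc
    ext1
    funext j
    exact Gr.eq_zero_of_subword_inr fun s =>
      congrFun (congrArg Subtype.val (congrFun hc s)) j
  have := LinearMap.finrank_le_finrank_of_injective hf
  simpa [Module.finrank_pi_fintype, finrank_codeB1 h0] using this

/-- Counting parity checks: among (m+1)nΔ coordinates, the right vertices impose n((m+1)Δ - k)
conditions and the left vertices n(m+1)(Δ - dim B₂). -/
theorem le_finrank_codeB {G : Matrix (Fin k) (Fin Δ) F[X]} (h0 : (coeffMatrix G 0).rank = k)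
    (B2 : Submodule F (Fin Δ → F)) :
    n * k ≤ Module.finrank F (codeB m Gr G B2) + n * (m + 1) * (Δ - Module.finrank F B2) := by
  let f1 : (Fin (m + 1) → Gr.Edge → F) →ₗ[F]
      (Fin n → (Fin (m + 1) → Fin Δ → F) ⧸ codeB1 m G) :=
    LinearMap.pi fun s => (codeB1 m G).mkQ ∘ₗ
      LinearMap.pi fun j => Gr.subwordHom F (Sum.inr s) ∘ₗ LinearMap.proj j
  let f2 : (Fin (m + 1) → Gr.Edge → F) →ₗ[F]
      (Fin n × Fin (m + 1) → (Fin Δ → F) ⧸ B2) :=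
    LinearMap.pi fun p => B2.mkQ ∘ₗ Gr.subwordHom F (Sum.inl p.1) ∘ₗ LinearMap.proj p.2
  have hker : LinearMap.ker (f1.prod f2) = codeB m Gr G B2 := by
    ext c
    rw [LinearMap.mem_ker, LinearMap.prod_apply, Prod.mk_eq_zero]
    refine and_congr ?_ ?_
    · rw [funext_iff]
      exact forall_congr' fun s => Submodule.Quotient.mk_eq_zero _
    · rw [funext_iff, Prod.forall]
      exact forall_congr' fun s => forall_congr' fun j => Submodule.Quotient.mk_eq_zero _
  have h1 := LinearMap.finrank_range_add_finrank_ker (f1.prod f2)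
  have h2 := Submodule.finrank_le (LinearMap.range (f1.prod f2))
  have h3 := Submodule.finrank_quotient_add_finrank (codeB1 m G)
  have h4 := Submodule.finrank_quotient_add_finrank B2
  rw [hker] at h1
  simp only [Module.finrank_prod, Module.finrank_pi_fintype, Finset.sum_const, Finset.card_univ,
    Fintype.card_fin, Fintype.card_prod, Module.finrank_self, smul_eq_mul, mul_one,
    finrank_codeB1 h0, Gr.card_edge] at h1 h2 h3 h4
  have h5 : Δ - Module.finrank F B2 = Module.finrank F ((Fin Δ → F) ⧸ B2) := by omega
  rw [h5]
  have h6 : (m + 1) * (n * Δ) = n * Module.finrank F ((Fin (m + 1) → Fin Δ → F) ⧸ codeB1 m G)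
      + n * k := by
    rw [← mul_add, h3]; ring
  omega

/-- The output at time `t` of the convolutional encoder with coefficients `Gt`. -/
def convOutput {E : Type} (Gt : Fin (m + 1) → Matrix (Fin kt) E F) (x : ℕ → Fin kt → F) (t : ℕ) :
    E → F :=
  ∑ i : Fin (m + 1), if (i : ℕ) ≤ t then x (t - i) ᵥ* Gt i else 0

theorem convOutput_zero {E : Type} (Gt : Fin (m + 1) → Matrix (Fin kt) E F)
    (x : ℕ → Fin kt → F) : convOutput Gt x 0 = x 0 ᵥ* Gt 0 := by
  rw [convOutput, Finset.sum_eq_single 0]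
  · simp
  · intro i _ hi
    rw [if_neg]
    simpa using hi
  · simp

/-! ### Local structure of the encoder output at the vertices -/

variable {Gr}
variable {G : Matrix (Fin k) (Fin Δ) F[X]} {B2 : Submodule F (Fin Δ → F)}
  {Gt : Fin (m + 1) → Matrix (Fin kt) Gr.Edge F}

theorem IsBlockGenerator.finrank_eq (h : IsBlockGenerator (codeB m Gr G B2) Gt) :
    Module.finrank F (codeB m Gr G B2) = kt := by
  rw [← h.2, finrank_span_eq_card h.1, Fintype.card_fin]

theorem IsBlockGenerator.vecMul_mem (h : IsBlockGenerator (codeB m Gr G B2) Gt)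
    (z : Fin kt → F) : (fun j => z ᵥ* Gt j) ∈ codeB m Gr G B2 := by
  rw [← h.2, Submodule.mem_span_range_iff_exists_fun]
  exact ⟨z, by ext j e; simp [vecMul, dotProduct]⟩

/-- At each right vertex the word of B is a·(G_0, …, G_m). If its time-0 part vanishes, full rank of
G_0 gives a = 0, so the whole word vanishes. Hence a nonzero first input produces a nonzero first
block, and the shift register is deterministic. -/
theorem IsBlockGenerator.eq_zero (h : IsBlockGenerator (codeB m Gr G B2) Gt)
    (h0 : (coeffMatrix G 0).rank = k) {z : Fin kt → F} (hz : z ᵥ* Gt 0 = 0) : z = 0 := by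
  have hb : (fun j => z ᵥ* Gt j) = 0 := by
    funext j
    refine Gr.eq_zero_of_subword_inr fun s => ?_
    obtain ⟨a, ha⟩ := mem_codeB1.1 ((h.vecMul_mem z).1 s)
    have ha0 : a = 0 := by
      refine eq_zero_of_vecMul_eq_zero h0 ?_
      have : Gr.subword (Sum.inr s) (z ᵥ* Gt 0) = _ := ha 0
      rw [hz] at this
      exact this.symm
    rw [ha j, ha0, zero_vecMul]
  ext i
  refine Fintype.linearIndependent_iff.1 h.1 z ?_ i
  rw [← hb]
  ext j e
  simp [vecMul, dotProduct]

theorem IsBlockGenerator.subword_inl_mem (h : IsBlockGenerator (codeB m Gr G B2) Gt)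
    (x : ℕ → Fin kt → F) (t : ℕ) (s : Fin n) :
    Gr.subword (Sum.inl s) (convOutput Gt x t) ∈ B2 := by
  change Gr.subwordHom F (Sum.inl s) (convOutput Gt x t) ∈ B2
  rw [convOutput, map_sum]
  refine B2.sum_mem fun i _ => ?_
  split_ifs
  · exact (h.vecMul_mem _).2 s i
  · rw [map_zero]; exact B2.zero_mem

/-- Each input x_t contributes a word of B, whose restriction at v_s comes from a local input a_t.
Superposing the delayed words turns the view at v_s into an output of G(D). -/
theorem IsBlockGenerator.exists_encode (h : IsBlockGenerator (codeB m Gr G B2) Gt)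
    (hm : memory G = m) (x : ℕ → Fin kt → F) (s : Fin n) :
    ∃ a : ℕ → Fin k → F, ∀ t,
      Gr.subword (Sum.inr s) (convOutput Gt x t) = encode G a t := by
  choose a ha using fun t => mem_codeB1.1 ((h.vecMul_mem (x t)).1 s)
  refine ⟨a, fun t => ?_⟩
  rw [encode_eq_sum_fin hm]
  change Gr.subwordHom F (Sum.inr s) (convOutput Gt x t) = _
  rw [convOutput, map_sum]
  refine Finset.sum_congr rfl fun i _ => ?_
  split_ifs
  · exact ha _ i
  · rw [map_zero]

end Blocks

/-! ### Shift registers as generator digraphs -/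

namespace LabeledDigraph

theorem Deterministic.lossless {L : Type v} {Γ : LabeledDigraph L} (h : Γ.Deterministic) :
    Γ.Lossless := by
  intro a b p p' hp hp' hne heq
  apply hne
  clear hne
  induction p generalizing a p' with
  | nil => exact (List.map_eq_nil_iff.1 heq.symm).symm
  | cons e p ih =>
    cases p' with
    | nil => simp at heq
    | cons e' p' =>
      simp only [List.map_cons, List.cons.injEq] at heq
      obtain rfl := h e e' (hp.1.trans hp'.1.symm) heq.1
      rw [ih _ _ hp.2 hp'.2 heq.2]

/-- The labelled de Bruijn graph: states are the last `m` inputs, the most recent one first, and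
edges are windows of `m + 1` consecutive inputs. -/
def deBruijn {L : Type v} (X : Type) [Finite X] [Nonempty X] (m : ℕ)
    (lab : (Fin (m + 1) → X) → L) : LabeledDigraph L where
  V := Fin m → X
  E := Fin (m + 1) → X
  finV := inferInstance
  nonemptyV := inferInstance
  finE := inferInstance
  src w := Fin.tail w
  tgt w := Fin.init w
  label := lab

variable {L : Type v} {X : Type} [Finite X] [Nonempty X] {m : ℕ} {lab : (Fin (m + 1) → X) → L}

theorem deBruijn_irreducible : (deBruijn X m lab).Irreducible := by
  intro a b
  -- The letters of b are shifted in oldest first. The hypothesis says that the j most recent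
  -- letters of a are the j oldest letters of b; the next letter to enter is b at m - j - 1.
  have key : ∀ j ≤ m, ∀ a : Fin m → X,
      (∀ i i' : Fin m, (i : ℕ) < j → (i' : ℕ) + j = m + i → a i = b i') →
      ∃ p, (deBruijn X m lab).IsPath a p b := by
    intro j hj
    induction hj using Nat.decreasingInduction with
    | self =>
      intro a ha
      exact ⟨[], funext fun i => ha i i i.2 (add_comm _ _)⟩
    | of_succ j hj ih =>
      intro a ha
      let w : Fin (m + 1) → X := Fin.cons (b ⟨m - j - 1, by omega⟩) a
      obtain ⟨p, hp⟩ := ih (Fin.init w) (by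
        rintro ⟨i, hi⟩ i' hij hi'
        rw [Fin.init]
        rcases i with _ | i
        · exact congrArg b (Fin.ext (by simp at hi' ⊢; omega))
        · exact ha ⟨i, by omega⟩ i' (by simpa using hij) (by simp at hi' ⊢; omega))
      exact ⟨w :: p, rfl, hp⟩
  exact key 0 (Nat.zero_le _) a fun i _ hi => absurd hi (Nat.not_lt_zero _)

theorem deBruijn_regular : (deBruijn X m lab).Regular (Nat.card X) := by
  intro (a : Fin m → X)
  rw [← Nat.card_coe_set_eq]
  refine (Nat.card_congr (Equiv.ofBijective
    (fun x : X => (⟨(Fin.cons x a : Fin (m + 1) → X), Fin.tail_cons (α := fun _ => X) x a⟩ :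
      {e : (deBruijn X m lab).E // (deBruijn X m lab).src e = a})) ⟨?_, ?_⟩)).symm
  · intro x y h
    exact congrFun (congrArg Subtype.val h) 0
  · rintro ⟨w, hw⟩
    refine ⟨(w : Fin (m + 1) → X) 0, Subtype.ext ?_⟩
    subst hw
    exact Fin.cons_self_tail (α := fun _ => X) w

theorem deBruijn_deterministic
    (h : ∀ w w', Fin.tail w = Fin.tail w' → lab w = lab w' → w 0 = w' 0) :
    (deBruijn X m lab).Deterministic := by
  intro w w' hs hl
  have h0 := h w w' hs hl
  have hs' : Fin.tail w = Fin.tail w' := hs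
  change (w : Fin (m + 1) → X) = w'
  rw [← Fin.cons_self_tail w, ← Fin.cons_self_tail w', hs', h0]

/-- The constant initial state stands for inputs equal to x0 before time 0; the input at time t is
the newest letter of the t-th window. -/
theorem deBruijn_sequences (x0 : X) :
    (deBruijn X m lab).sequences (fun _ => x0 : Fin m → X) =
      {c | ∃ x : ℕ → X, ∀ t,
        c t = lab fun i : Fin (m + 1) => if (i : ℕ) ≤ t then x (t - i) else x0} := by
  ext c
  constructor
  · rintro ⟨p, h0, hp, hc⟩
    have hp' : ∀ (t : ℕ) (i : Fin m), (p (t + 1) : Fin (m + 1) → X) i.succ =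
        (p t : Fin (m + 1) → X) i.castSucc := fun t i => (congrFun (hp t) i).symm
    have h0' : ∀ i : Fin m, (p 0 : Fin (m + 1) → X) i.succ = x0 := fun i => congrFun h0 i
    refine ⟨fun t => (p t : Fin (m + 1) → X) 0, fun t => (hc t).trans (congrArg lab ?_)⟩
    funext i
    induction t generalizing i with
    | zero =>
      cases i using Fin.cases with
      | zero => simp
      | succ i => simpa using h0' i
    | succ t ih =>
      cases i using Fin.cases with
      | zero => simp
      | succ i =>
        rw [hp' t i, ih]
        simp
  · rintro ⟨x, hx⟩
    refine ⟨fun t => (fun i : Fin (m + 1) => if (i : ℕ) ≤ t then x (t - i) else x0),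
      ?_, ?_, hx⟩
    · funext i
      change (if ((i.succ : Fin (m + 1)) : ℕ) ≤ 0 then x (0 - (i.succ : Fin (m + 1))) else x0) = x0
      simp
    · intro t
      funext i
      change (if ((i.castSucc : Fin (m + 1)) : ℕ) ≤ t then _ else _) =
        (if ((i.succ : Fin (m + 1)) : ℕ) ≤ t + 1 then _ else _)
      simp only [Fin.val_castSucc, Fin.val_succ, Nat.add_le_add_iff_right,
        Nat.add_sub_add_right]

end LabeledDigraph

/-! ### The code over the large alphabet: generator digraph, degree and distances -/

section CodePhi

variable {F : Type u} [Field F] {k n Δ m kt : ℕ} {Gr : BipartiteGraph n Δ}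
  {G : Matrix (Fin k) (Fin Δ) F[X]} {B2 : Submodule F (Fin Δ → F)}
  {K : Type v} [Field K] [Algebra F K] {φ : B2 ≃ₗ[F] K}
  {Gt : Fin (m + 1) → Matrix (Fin kt) Gr.Edge F}

theorem BipartiteGraph.eq_zero_of_subword_inl {x : Gr.Edge → F}
    (h : ∀ a, Gr.subword (Sum.inl a) x = 0) : x = 0 := by
  by_contra hx
  obtain ⟨a, b, hab⟩ := Gr.exists_edgeValue_ne_zero hx
  exact Gr.subword_inl_ne_zero hab (h a)

theorem mem_codePhi (h : IsBlockGenerator (codeB m Gr G B2) Gt) {Y : ℕ → Fin n → K} :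
    Y ∈ codePhi Gr B2 φ Gt ↔ ∃ x : ℕ → Fin kt → F, ∀ t s,
      Y t s = φ ⟨Gr.subword (Sum.inl s) (convOutput Gt x t), h.subword_inl_mem x t s⟩ := by
  constructor
  · rintro ⟨c, ⟨x, hx⟩, hY⟩
    obtain rfl : c = convOutput Gt x := funext hx
    exact ⟨x, fun t s => (hY t s).2⟩
  · rintro ⟨x, hY⟩
    exact ⟨convOutput Gt x, ⟨x, fun _ => rfl⟩, fun t s => ⟨_, hY t s⟩⟩

theorem convOutput_sub (Gt : Fin (m + 1) → Matrix (Fin kt) Gr.Edge F) (x x' : ℕ → Fin kt → F)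
    (t : ℕ) : convOutput Gt (x - x') t = convOutput Gt x t - convOutput Gt x' t := by
  rw [convOutput, convOutput, convOutput, ← Finset.sum_sub_distrib]
  refine Finset.sum_congr rfl fun i _ => ?_
  split_ifs
  · rw [Pi.sub_apply, sub_vecMul]
  · rw [sub_zero]

open Classical in
/-- Distances of codewords are weights of left supports. -/
theorem exists_hammingDist_eq (h : IsBlockGenerator (codeB m Gr G B2) Gt) {Y Y' : ℕ → Fin n → K}
    (hY : Y ∈ codePhi Gr B2 φ Gt) (hY' : Y' ∈ codePhi Gr B2 φ Gt) :
    ∃ x : ℕ → Fin kt → F,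
      ∀ t, hammingDist (Y t) (Y' t) = (Gr.leftSupport (convOutput Gt x t)).card := by
  obtain ⟨x, hx⟩ := (mem_codePhi h).1 hY
  obtain ⟨x', hx'⟩ := (mem_codePhi h).1 hY'
  refine ⟨x - x', fun t => ?_⟩
  rw [hammingDist, BipartiteGraph.leftSupport]
  congr 1
  ext s
  simp only [Finset.mem_filter, Finset.mem_univ, true_and, hx t s, hx' t s]
  rw [not_iff_not, φ.injective.eq_iff, Subtype.mk.injEq, convOutput_sub, ← sub_eq_zero]
  rfl

/-- The shift register is a deterministic generator digraph. -/
theorem exists_generator [Finite F] (h : IsBlockGenerator (codeB m Gr G B2) Gt)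
    (h0 : (coeffMatrix G 0).rank = k) :
    ∃ Γ : LabeledDigraph (Fin n → K), Γ.IsGenerator (Nat.card F ^ kt) (codePhi Gr B2 φ Gt) ∧
      Γ.Deterministic ∧ Nat.card Γ.V = Nat.card F ^ (m * kt) := by
  -- The states of a digraph live in `Type`, while `F` lies in an arbitrary universe, so inputs are
  -- renumbered by a finite ordinal.
  let I := Fin (Nat.card (Fin kt → F))
  let e : I ≃ (Fin kt → F) := (Finite.equivFin (Fin kt → F)).symm
  have : Nonempty I := ⟨e.symm 0⟩
  have hcard : Nat.card I = Nat.card F ^ kt := by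
    rw [Nat.card_fin, Nat.card_fun, Nat.card_fin]
  have hmem : ∀ (w : Fin (m + 1) → I) (s : Fin n),
      Gr.subword (Sum.inl s) (∑ i, e (w i) ᵥ* Gt i) ∈ B2 := by
    intro w s
    change Gr.subwordHom F (Sum.inl s) (∑ i, e (w i) ᵥ* Gt i) ∈ B2
    rw [map_sum]
    exact B2.sum_mem fun i _ => (h.vecMul_mem _).2 s i
  let lab : (Fin (m + 1) → I) → Fin n → K := fun w s =>
    φ ⟨Gr.subword (Sum.inl s) (∑ i, e (w i) ᵥ* Gt i), hmem w s⟩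
  have hdet : (LabeledDigraph.deBruijn I m lab).Deterministic := by
    refine LabeledDigraph.deBruijn_deterministic fun w w' hs hl => ?_
    -- Equal labels force equal blocks, since φ is injective and every edge has a left end. The
    -- common past cancels, and injectivity of G̃_0 identifies the newest inputs.
    have h1 : (∑ i, e (w i) ᵥ* Gt i) - ∑ i, e (w' i) ᵥ* Gt i = 0 := by
      refine BipartiteGraph.eq_zero_of_subword_inl fun s => ?_
      have := φ.injective (congrFun hl s)
      rw [Subtype.mk.injEq] at this
      exact sub_eq_zero.2 this
    rw [Fin.sum_univ_succ, Fin.sum_univ_succ] at h1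
    have h2 : ∀ i : Fin m, w i.succ = w' i.succ := fun i => congrFun hs i
    simp only [h2, add_sub_add_right_eq_sub, ← sub_vecMul] at h1
    exact e.injective (sub_eq_zero.1 (h.eq_zero h0 h1))
  refine ⟨LabeledDigraph.deBruijn I m lab, ⟨LabeledDigraph.deBruijn_irreducible, hdet.lossless,
    hcard ▸ LabeledDigraph.deBruijn_regular, (fun _ => e.symm 0 : Fin m → I), ?_⟩, hdet, ?_⟩
  · rw [LabeledDigraph.deBruijn_sequences]
    ext Y
    rw [mem_codePhi h]
    have hout : ∀ (x : ℕ → I) (t : ℕ),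
        ∑ i : Fin (m + 1), e (if (i : ℕ) ≤ t then x (t - i) else e.symm 0) ᵥ* Gt i =
          convOutput Gt (fun t => e (x t)) t := by
      intro x t
      refine Finset.sum_congr rfl fun i _ => ?_
      split_ifs <;> simp
    constructor
    · rintro ⟨x, hx⟩
      refine ⟨fun t => e.symm (x t), fun t => funext fun s => ?_⟩
      rw [hx t s]
      refine congrArg φ (Subtype.ext ?_)
      have := hout (fun t => e.symm (x t)) t
      simp only [Equiv.apply_symm_apply] at this
      exact congrArg (Gr.subword (Sum.inl s)) this.symm
    · rintro ⟨x, hx⟩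
      refine ⟨fun t => e (x t), fun t s => ?_⟩
      rw [hx t]
      refine congrArg φ (Subtype.ext ?_)
      simp only [hout]
  · change Nat.card (Fin m → I) = _
    rw [Nat.card_fun, hcard, Nat.card_fin, ← pow_mul, mul_comm]

theorem natCard_eq_pow [Finite F] (φ : B2 ≃ₗ[F] K) :
    Nat.card K = Nat.card F ^ Module.finrank F B2 := by
  rw [← Nat.card_congr φ.toEquiv]
  exact Module.natCard_eq_pow_finrank

/-- The field K is nontrivial, so the existence of φ already yields the assumption r > 0. -/
theorem finrank_pos_of_equiv [Finite F] (φ : B2 ≃ₗ[F] K) : 0 < Module.finrank F B2 := by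
  have : Nontrivial B2 := φ.toEquiv.nontrivial
  exact Module.finrank_pos

theorem logb_natCard_pow [Finite F] (φ : B2 ≃ₗ[F] K) (d : ℕ) :
    Real.logb (Nat.card K) ((Nat.card F ^ d : ℕ) : ℝ) = d / Module.finrank F B2 := by
  have h1 : (1 : ℝ) < Nat.card F := by exact_mod_cast Finite.one_lt_card
  rw [natCard_eq_pow φ, Nat.cast_pow, Nat.cast_pow, Real.logb, Real.log_pow, Real.log_pow,
    mul_div_mul_right]
  exact (Real.log_pos h1).ne'

theorem trellisDegree_le [Finite F] (h : IsBlockGenerator (codeB m Gr G B2) Gt)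
    (h0 : (coeffMatrix G 0).rank = k) :
    trellisDegree (codePhi Gr B2 φ Gt) ≤ (m * kt : ℕ) / Module.finrank F B2 := by
  obtain ⟨Γ, hΓ, -, hV⟩ := exists_generator (φ := φ) h h0
  rw [← logb_natCard_pow φ, ← hV]
  -- A real infimum is meaningful only for a set bounded below; 0 is a bound because a digraph has
  -- at least one state.
  refine csInf_le ⟨0, ?_⟩ ⟨Γ, ⟨_, hΓ⟩, rfl⟩
  rintro _ ⟨Γ', -, rfl⟩
  have := Γ'.finV
  have := Γ'.nonemptyV
  have hK : Finite K := Finite.of_equiv _ φ.toEquiv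
  refine Real.logb_nonneg ?_ ?_
  · exact_mod_cast Finite.one_lt_card
  · exact_mod_cast Nat.card_pos

/-- The ceiling moves a real bound into ℕ∞, where D may be infinite. Negative β are harmless, as
`ENNReal.ofReal` and the natural ceiling both truncate at 0. -/
theorem ofReal_le_div_of_ceil_le {β : ℝ} {N : ℕ} (hN : 0 < N) {D : ℕ∞}
    (h : (⌈β * N⌉₊ : ℕ∞) ≤ D) : ENNReal.ofReal β ≤ (D : ℝ≥0∞) / (N : ℝ≥0∞) := by
  rw [ENNReal.le_div_iff_mul_le (Or.inl (by exact_mod_cast hN.ne'))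
    (Or.inl (ENNReal.natCast_ne_top N)), ← ENNReal.ofReal_natCast,
    ← ENNReal.ofReal_mul' (Nat.cast_nonneg N)]
  refine (ENNReal.ofReal_le_ofReal (Nat.le_ceil _)).trans ?_
  rw [ENNReal.ofReal_natCast]
  exact_mod_cast ENat.toENNReal_le.2 h

theorem le_columnDist (h : IsBlockGenerator (codeB m Gr G B2) Gt) {j W : ℕ}
    (hW : ∀ x : ℕ → Fin kt → F, x 0 ≠ 0 →
      W ≤ ∑ t ∈ Finset.range (j + 1), (Gr.leftSupport (convOutput Gt x t)).card) :
    (W : ℕ∞) ≤ columnDist (codePhi Gr B2 φ Gt) j := by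
  classical
  refine le_iInf₂ fun Y hY => le_iInf₂ fun Y' hY' => le_iInf fun hne => ?_
  obtain ⟨x, hx⟩ := exists_hammingDist_eq h hY hY'
  rw [Nat.cast_le]
  refine (hW x fun hx0 => hne ?_).trans_eq (Finset.sum_congr rfl fun t _ => ?_)
  · rw [← hammingDist_eq_zero]
    have := hx 0
    rw [convOutput_zero, hx0, zero_vecMul] at this
    rw [this]
    simp [BipartiteGraph.leftSupport, show ∀ w, Gr.subword w (0 : Gr.Edge → F) = 0 from fun _ => rfl]
  · rw [← hx t]

theorem convOutput_shift (Gt : Fin (m + 1) → Matrix (Fin kt) Gr.Edge F) {x : ℕ → Fin kt → F}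
    {t₀ : ℕ} (hx : ∀ t < t₀, x t = 0) (t : ℕ) :
    convOutput Gt x (t₀ + t) = convOutput Gt (fun s => x (t₀ + s)) t := by
  refine Finset.sum_congr rfl fun i _ => ?_
  by_cases hi : (i : ℕ) ≤ t
  · rw [if_pos hi, if_pos (by omega), Nat.add_sub_assoc hi]
  · rw [if_neg hi]
    split_ifs
    · rw [hx _ (by omega), zero_vecMul]
    · rfl

/-- By time invariance, the zeros before the first nonzero input can be dropped; the j + 1 blocks
from that time on already have total weight at least W. -/
theorem le_freeDist (h : IsBlockGenerator (codeB m Gr G B2) Gt) {j W : ℕ}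
    (hW : ∀ x : ℕ → Fin kt → F, x 0 ≠ 0 →
      W ≤ ∑ t ∈ Finset.range (j + 1), (Gr.leftSupport (convOutput Gt x t)).card) :
    (W : ℕ∞) ≤ freeDist (codePhi Gr B2 φ Gt) := by
  classical
  refine le_iInf₂ fun Y hY => le_iInf₂ fun Y' hY' => le_iInf fun hne => ?_
  obtain ⟨x, hx⟩ := exists_hammingDist_eq h hY hY'
  have hx0 : ∃ t, x t ≠ 0 := by
    by_contra! hx0
    apply hne
    funext t
    rw [← hammingDist_eq_zero]
    have := hx t
    rw [convOutput, Finset.sum_eq_zero (fun i _ => by rw [hx0]; simp)] at this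
    rw [this]
    simp [BipartiteGraph.leftSupport, show ∀ w, Gr.subword w (0 : Gr.Edge → F) = 0 from fun _ => rfl]
  have hlt : ∀ t < Nat.find hx0, x t = 0 := fun t ht => not_not.1 (Nat.find_min hx0 ht)
  have h1 := hW (fun s => x (Nat.find hx0 + s)) (Nat.find_spec hx0)
  refine le_trans ?_ (le_iSup _ (Nat.find hx0 + (j + 1)))
  rw [Nat.cast_le, Finset.sum_range_add]
  refine le_trans h1 (le_trans (le_of_eq ?_) (Nat.le_add_left _ _))
  refine Finset.sum_congr rfl fun t _ => ?_
  rw [← convOutput_shift Gt hlt, ← hx]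

end CodePhi

/-! ### The parameters of the construction -/

/-- The elementary estimate behind the lower bound for the number of active right vertices. -/
theorem le_mul_of_mixing {c γ θ η ε p q : ℝ} (hp : 0 < p) (hq : 0 < q) (hγ : 0 ≤ γ)
    (hθ : 0 < θ) (hε : 0 < ε) (hε1 : ε ≤ 1) (hεc : ε ≤ c) (hη : η = ε / 4) (hγη : γ ≤ η * √θ)
    (h1 : c * p ≤ p * q ^ 2 + γ * q) (h2 : θ * q ≤ p ^ 2 * q + γ * p) : γ ≤ ε * p := by
  -- In the application p² = |S|/n, q² = |T|/n and c = 1 - k/Δ.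
  by_contra! hlt
  have hγ2 : γ ^ 2 ≤ ε ^ 2 / 16 * θ := by
    calc γ ^ 2 ≤ (η * √θ) ^ 2 := pow_le_pow_left₀ hγ hγη 2
      _ = ε ^ 2 / 16 * θ := by rw [mul_pow, Real.sq_sqrt hθ.le, hη]; ring
  have hε2 : ε ^ 2 ≤ ε := by nlinarith
  -- If p² ≥ θ/2, then γ > εp contradicts the upper bound on γ² directly. Otherwise p²q takes at
  -- most half of θq in `h2`, leaving θq/2 ≤ γp; this makes q small, so that `h1` gives εp/2 ≤ γq.
  rcases le_or_gt (θ / 2) (p ^ 2) with hcase | hcase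
  · have h3 : (ε * p) ^ 2 < γ ^ 2 := pow_lt_pow_left₀ hlt (by positivity) two_ne_zero
    have h4 : ε ^ 2 / 16 * θ ≤ ε ^ 2 / 16 * (2 * p ^ 2) :=
      mul_le_mul_of_nonneg_left (by linarith) (by positivity)
    have h5 : 0 < (ε * p) ^ 2 := by positivity
    nlinarith
  · have h3 : θ / 2 * q ≤ γ * p := by
      have := mul_le_mul_of_nonneg_right hcase.le hq.le
      linarith
    have h4 : q ≤ ε / 8 := by
      have h5 : ε * (θ / 2 * q) ≤ γ ^ 2 := by
        calc ε * (θ / 2 * q) ≤ ε * (γ * p) := mul_le_mul_of_nonneg_left h3 hε.le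
          _ = γ * (ε * p) := by ring
          _ ≤ γ * γ := mul_le_mul_of_nonneg_left hlt.le hγ
          _ = γ ^ 2 := by ring
      have h6 : (ε * θ / 2) * q ≤ (ε * θ / 2) * (ε / 8) := by linarith
      exact le_of_mul_le_mul_left h6 (by positivity)
    have h5 : q ^ 2 ≤ ε / 2 := by nlinarith
    have h6 : ε / 2 * p ≤ γ * q := by
      have := mul_le_mul_of_nonneg_right hεc hp.le
      have := mul_le_mul_of_nonneg_left h5 hp.le
      linarith
    -- Multiplying the two estimates cancels pq and leaves γ² ≥ εθ/4, against γ² ≤ ε²θ/16.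
    have h7 : (ε / 2 * p) * (θ / 2 * q) ≤ (γ * q) * (γ * p) :=
      mul_le_mul h6 h3 (by positivity) (by positivity)
    have h8 : (p * q) * (ε * θ / 4) ≤ (p * q) * γ ^ 2 := by linarith
    have h9 := le_of_mul_le_mul_left h8 (by positivity)
    have h10 : ε ^ 2 / 16 * θ ≤ ε / 16 * θ := by
      apply mul_le_mul_of_nonneg_right _ hθ.le; linarith
    have : 0 < ε * θ := by positivity
    linarith

section Parameters

variable {F : Type u} [Field F] {k n Δ m kt : ℕ} {Gr : BipartiteGraph n Δ}
  {C : Submodule F[X] (Fin Δ → F[X])} {G : Matrix (Fin k) (Fin Δ) F[X]}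
  {B2 : Submodule F (Fin Δ → F)} {Gt : Fin (m + 1) → Matrix (Fin kt) Gr.Edge F}

open Classical in
theorem relDist_mul_le {c : Fin Δ → F} (hc : c ∈ B2) (h0 : c ≠ 0) :
    relDist B2 * Δ ≤ hammingNorm c := by
  have hΔ : (Δ : ℝ) ≠ 0 := by
    rw [Nat.cast_ne_zero]
    rintro rfl
    exact h0 (Subsingleton.elim _ _)
  rw [relDist, div_mul_cancel₀ _ hΔ, Nat.cast_le]
  exact Nat.sInf_le ⟨c, hc, h0, rfl⟩

/-- A nonzero word has weight at least 1. Nontriviality of B₂ keeps the infimum away from its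
default value 0. This gives θ > 0, and lets the second part dispense with θ. -/
theorem one_div_le_relDist (hB : 0 < Module.finrank F B2) : 1 / (Δ : ℝ) ≤ relDist B2 := by
  classical
  have : Nontrivial B2 := Module.finrank_pos_iff.1 hB
  obtain ⟨c, hc⟩ := exists_ne (0 : B2)
  have hc0 : (c : Fin Δ → F) ≠ 0 := fun h => hc (Subtype.ext h)
  refine div_le_div_of_nonneg_right (Nat.one_le_cast.2 ?_) (Nat.cast_nonneg Δ)
  obtain ⟨w, -, hw, hwt⟩ := Nat.sInf_mem (s := {w | ∃ c ∈ B2, c ≠ 0 ∧ hammingNorm c = w})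
    ⟨_, c, c.2, hc0, rfl⟩
  rw [← hwt]
  exact hammingNorm_pos_iff.2 hw

/-- Counting the symbols of the codewords at the active right vertices. -/
theorem card_rightSupport_mul_le (hC : IsMDP k C) (hG : IsGeneratorMatrix C G)
    (h0 : (coeffMatrix G 0).rank = k) (hm : memory G = m)
    (h : IsBlockGenerator (codeB m Gr G B2) Gt) (x : ℕ → Fin kt → F) {j : ℕ}
    (hj : j ≤ profileLength k C) :
    (Gr.rightSupport (convOutput Gt x 0)).card * ((Δ - k) * (j + 1) + 1) ≤
      ∑ t ∈ Finset.range (j + 1), Gr.edgeCount (Gr.leftSupport (convOutput Gt x t))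
        (Gr.rightSupport (convOutput Gt x 0)) := by
  classical
  refine le_trans ?_ (Finset.sum_le_sum fun t _ =>
    Gr.sum_hammingNorm_subword_inr_le (convOutput Gt x t) _)
  rw [Finset.sum_comm, ← smul_eq_mul]
  refine Finset.card_nsmul_le_sum _ _ _ fun b hb => ?_
  obtain ⟨a, ha⟩ := h.exists_encode hm x b
  have ha0 : a 0 ≠ 0 := by
    intro ha0
    apply (Finset.mem_filter.1 hb).2
    rw [ha 0, encode_zero, ha0, zero_vecMul]
  refine (le_sum_hammingNorm_encode hC hG h0 hj ha0).trans_eq ?_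
  exact Finset.sum_congr rfl fun t _ => by rw [ha t]

theorem card_leftSupport_mul_le (h : IsBlockGenerator (codeB m Gr G B2) Gt)
    (x : ℕ → Fin kt → F) (t : ℕ) :
    (Gr.leftSupport (convOutput Gt x t)).card * (relDist B2 * Δ) ≤
      Gr.edgeCount (Gr.leftSupport (convOutput Gt x t)) (Gr.rightSupport (convOutput Gt x t)) := by
  classical
  refine le_trans ?_ (Nat.cast_le.2
    (Gr.sum_hammingNorm_subword_inl_le (convOutput Gt x t) (Gr.leftSupport (convOutput Gt x t))))
  rw [Nat.cast_sum, ← nsmul_eq_mul]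
  exact Finset.card_nsmul_le_sum _ _ _ fun a ha =>
    relDist_mul_le (h.subword_inl_mem x t a) (Finset.mem_filter.1 ha).2

/-- Many right vertices are active at time `0`. -/
theorem gamma_mul_sqrt_le (hk : k < Δ) (hn : 1 ≤ n) (hC : IsMDP k C) (hG : IsGeneratorMatrix C G)
    (h0 : (coeffMatrix G 0).rank = k) (hm : memory G = m) (hB : 0 < Module.finrank F B2)
    (h : IsBlockGenerator (codeB m Gr G B2) Gt) {γ ε : ℝ} (hγ : Gr.IsSpectralExpander γ)
    (hε : 0 < ε) (hεk : ε ≤ 1 - k / Δ) (hγε : γ ≤ ε / 4 * √(relDist B2))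
    {x : ℕ → Fin kt → F} (hx : x 0 ≠ 0) :
    γ * √n ≤ ε * √(Gr.rightSupport (convOutput Gt x 0)).card := by
  have hne : convOutput Gt x 0 ≠ 0 := by
    rw [convOutput_zero]
    exact fun hz => hx (h.eq_zero h0 hz)
  have hΔ : (0 : ℝ) < Δ := by exact_mod_cast (Nat.zero_le k).trans_lt hk
  have hn0 : (0 : ℝ) < n := by exact_mod_cast hn
  have h1 : _ ≤ _ := card_rightSupport_mul_le hC hG h0 hm h x (Nat.zero_le _)
  have h2 := card_leftSupport_mul_le h x 0
  simp only [zero_add, Finset.range_one, Finset.sum_singleton, mul_one] at h1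
  have h3 := Gr.edgeCount_le hn hγ (Gr.leftSupport (convOutput Gt x 0))
    (Gr.rightSupport (convOutput Gt x 0))
  have hS : (0 : ℝ) < (Gr.rightSupport (convOutput Gt x 0)).card :=
    Nat.cast_pos.2 (Finset.card_pos.2 (Gr.rightSupport_nonempty hne))
  have hT : (0 : ℝ) < (Gr.leftSupport (convOutput Gt x 0)).card :=
    Nat.cast_pos.2 (Finset.card_pos.2 (Gr.leftSupport_nonempty hne))
  have h1' : ((Gr.rightSupport (convOutput Gt x 0)).card : ℝ) * (Δ - k + 1) ≤
      Gr.edgeCount (Gr.leftSupport (convOutput Gt x 0)) (Gr.rightSupport (convOutput Gt x 0)) := by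
    rw [← Nat.cast_sub hk.le]
    exact_mod_cast h1
  generalize (Gr.edgeCount (Gr.leftSupport (convOutput Gt x 0))
    (Gr.rightSupport (convOutput Gt x 0)) : ℝ) = e at h1' h2 h3
  generalize ((Gr.rightSupport (convOutput Gt x 0)).card : ℝ) = s at *
  generalize ((Gr.leftSupport (convOutput Gt x 0)).card : ℝ) = t at *
  -- Square roots of the densities turn the mixing bound into Δnpq(pq + γ), from which the factors
  -- Δnp and Δnq can be cancelled.
  obtain ⟨p, hp, rfl⟩ : ∃ p : ℝ, 0 < p ∧ p ^ 2 * n = s :=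
    ⟨√(s / n), by positivity, by rw [Real.sq_sqrt (by positivity)]; field_simp⟩
  obtain ⟨q, hq, rfl⟩ : ∃ q : ℝ, 0 < q ∧ q ^ 2 * n = t :=
    ⟨√(t / n), by positivity, by rw [Real.sq_sqrt (by positivity)]; field_simp⟩
  have hsp : √(p ^ 2 * n) = p * √n := by rw [Real.sqrt_mul (by positivity), Real.sqrt_sq hp.le]
  have hsq : √(q ^ 2 * n) = q * √n := by rw [Real.sqrt_mul (by positivity), Real.sqrt_sq hq.le]
  have hnn : √(n : ℝ) * √n = n := Real.mul_self_sqrt hn0.le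
  have h3' : e ≤ Δ * n * p * q * (p * q + γ) := by
    refine h3.trans_eq ?_
    rw [hsp, hsq, show p * √(n : ℝ) * (q * √n) = p * q * (√n * √n) by ring, hnn]
    field_simp
  rw [hsp, ← mul_assoc]
  refine mul_le_mul_of_nonneg_right ?_ (Real.sqrt_nonneg _)
  have hε1 : ε ≤ 1 := hεk.trans (by linarith [show (0 : ℝ) ≤ k / Δ by positivity])
  refine le_mul_of_mixing hp hq hγ.1 ((one_div_pos.2 hΔ).trans_le (one_div_le_relDist hB)) hε hε1 hεk rfl hγε ?_ ?_
  · have hkey : (Δ * n * p) * ((1 - k / Δ) * p) ≤ (Δ * n * p) * (p * q ^ 2 + γ * q) := by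
      have : (Δ * n * p) * ((1 - k / Δ) * p) = p ^ 2 * n * (Δ - k) := by field_simp
      rw [this]
      have hpos : 0 ≤ p ^ 2 * n := by positivity
      linarith
    exact le_of_mul_le_mul_left hkey (by positivity)
  · have hkey : (Δ * n * q) * (relDist B2 * q) ≤ (Δ * n * q) * (p ^ 2 * q + γ * p) := by linarith
    exact le_of_mul_le_mul_left hkey (by positivity)

/-- The main distance estimate. Since |T_t| ≤ n, the mixing error at each time is at most γ√(|S|n) ≤
ε|S|, up to the factor Δ. The surplus n/Δ is the +1 of the MDP bound. -/
theorem le_sum_card_leftSupport (hk : k < Δ) (hn : 1 ≤ n) (hC : IsMDP k C)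
    (hG : IsGeneratorMatrix C G) (h0 : (coeffMatrix G 0).rank = k) (hm : memory G = m)
    (hB : 0 < Module.finrank F B2) (h : IsBlockGenerator (codeB m Gr G B2) Gt) {γ ε : ℝ}
    (hγ : Gr.IsSpectralExpander γ) (hε : 0 < ε) (hεk : ε ≤ 1 - k / Δ)
    (hγε : γ ≤ ε / 4 * √(relDist B2)) {x : ℕ → Fin kt → F} (hx : x 0 ≠ 0) {j : ℕ}
    (hj : j ≤ profileLength k C) :
    (1 - k / Δ - ε) * ((j + 1) * n) + n / Δ ≤
      ∑ t ∈ Finset.range (j + 1), ((Gr.leftSupport (convOutput Gt x t)).card : ℝ) := by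
  have hne : convOutput Gt x 0 ≠ 0 := by
    rw [convOutput_zero]
    exact fun hz => hx (h.eq_zero h0 hz)
  have hΔ : (0 : ℝ) < Δ := by exact_mod_cast (Nat.zero_le k).trans_lt hk
  have hn0 : (0 : ℝ) < n := by exact_mod_cast hn
  have hS : (0 : ℝ) < (Gr.rightSupport (convOutput Gt x 0)).card :=
    Nat.cast_pos.2 (Finset.card_pos.2 (Gr.rightSupport_nonempty hne))
  have h1 := card_rightSupport_mul_le hC hG h0 hm h x hj
  have h2 := gamma_mul_sqrt_le hk hn hC hG h0 hm hB h hγ hε hεk hγε hx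
  set S := Gr.rightSupport (convOutput Gt x 0)
  have h3 : ∀ t, (Gr.edgeCount (Gr.leftSupport (convOutput Gt x t)) S : ℝ) ≤
      Δ * (S.card * (Gr.leftSupport (convOutput Gt x t)).card / n + ε * S.card) := by
    intro t
    refine (Gr.edgeCount_le hn hγ _ S).trans (mul_le_mul_of_nonneg_left ?_ hΔ.le)
    refine add_le_add le_rfl ?_
    have hT : √((Gr.leftSupport (convOutput Gt x t)).card : ℝ) ≤ √n :=
      Real.sqrt_le_sqrt (by exact_mod_cast card_finset_fin_le _)
    calc γ * (√(S.card : ℝ) * √(Gr.leftSupport (convOutput Gt x t)).card)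
        ≤ γ * (√(S.card : ℝ) * √n) := by
          have := hγ.1
          gcongr
      _ = √(S.card : ℝ) * (γ * √n) := by ring
      _ ≤ √(S.card : ℝ) * (ε * √S.card) := mul_le_mul_of_nonneg_left h2 (Real.sqrt_nonneg _)
      _ = ε * S.card := by
          rw [mul_left_comm, Real.mul_self_sqrt hS.le]
  have h4 : (S.card : ℝ) * ((Δ - k) * (j + 1) + 1) ≤ ∑ t ∈ Finset.range (j + 1),
      Δ * (S.card * ((Gr.leftSupport (convOutput Gt x t)).card : ℝ) / n + ε * S.card) := by
    refine le_trans ?_ (Finset.sum_le_sum fun t _ => h3 t)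
    rw [← Nat.cast_sub hk.le]
    exact_mod_cast h1
  rw [← Finset.mul_sum, Finset.sum_add_distrib, ← Finset.sum_div, ← Finset.mul_sum,
    Finset.sum_const, Finset.card_range, nsmul_eq_mul] at h4
  generalize ∑ t ∈ Finset.range (j + 1), ((Gr.leftSupport (convOutput Gt x t)).card : ℝ) = W at *
  push_cast at h4
  have h5 : (S.card * Δ / n : ℝ) * ((1 - k / Δ - ε) * ((j + 1) * n) + n / Δ) ≤
      (S.card * Δ / n : ℝ) * W := by
    have e1 : (S.card * Δ / n : ℝ) * ((1 - k / Δ - ε) * ((j + 1) * n) + n / Δ) =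
      S.card * ((Δ - k) * (j + 1) + 1) - Δ * ((j + 1) * (ε * S.card)) := by
      field_simp
      ring
    have e2 : (S.card * Δ / n : ℝ) * W = Δ * (S.card * W / n) := by ring
    rw [e1, e2]
    linarith
  exact le_of_mul_le_mul_left h5 (by positivity)

theorem convDegree_eq (hG : IsReducedGenerator C G)
    (hr : ∀ i i', rowDegree G i = rowDegree G i') : convDegree k C = k * memory G := by
  have hmem : ∀ i, rowDegree G i = memory G := by
    intro i
    refine le_antisymm (Finset.le_sup (f := rowDegree G) (Finset.mem_univ i)) ?_
    exact Finset.sup_le fun i' _ => (hr i' i).le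
  rw [← hG.2, constraintLength, Finset.sum_congr rfl fun i _ => hmem i]
  simp

variable {K : Type v} [Field K] [Algebra F K] {φ : B2 ≃ₗ[F] K}

/-- Both parts reduce to two inequalities. With d = dim B₂, passing from k/Δ to k/d costs at most
(Δ-d)/d and the lost dimensions cost at most (m+1)(Δ-d)/d; `hd` bounds the latter by ε, and also the
degree error m(Δ-d)/d. -/
theorem hasParameters_of_le [Finite F] (hk : k < Δ) (hn : 1 ≤ n)
    (hG : IsReducedGenerator C G) (hr : ∀ i i', rowDegree G i = rowDegree G i')
    (h0 : (coeffMatrix G 0).rank = k) (hm : memory G = m)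
    (h : IsBlockGenerator (codeB m Gr G B2) Gt) {ε : ℝ}
    (hd : (m + 1) * ((Δ : ℝ) - Module.finrank F B2) ≤ ε * Module.finrank F B2)
    (hW : ∀ j ≤ profileLength k C, ∀ x : ℕ → Fin kt → F, x 0 ≠ 0 →
      (1 - k / Δ - ε) * ((j + 1) * n) ≤
        ∑ t ∈ Finset.range (j + 1), ((Gr.leftSupport (convOutput Gt x t)).card : ℝ)) :
    HasParameters Δ k (convDegree k C) (profileLength k C) (codePhi Gr B2 φ Gt) ε := by
  obtain ⟨Γ, hΓ, hdet, -⟩ := exists_generator (φ := φ) h h0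
  have hΔ : (0 : ℝ) < Δ := by exact_mod_cast (Nat.zero_le k).trans_lt hk
  have hn0 : (0 : ℝ) < n := by exact_mod_cast hn
  have hd0 : (0 : ℝ) < Module.finrank F B2 := by exact_mod_cast finrank_pos_of_equiv φ
  have hdΔ' : Module.finrank F B2 ≤ Δ := by simpa using Submodule.finrank_le B2
  have hdΔ : (Module.finrank F B2 : ℝ) ≤ Δ := by exact_mod_cast hdΔ'
  have hkΔ : (k : ℝ) ≤ Δ := by exact_mod_cast hk.le
  have hkt1 : (kt : ℝ) ≤ n * k := by
    exact_mod_cast h.finrank_eq ▸ finrank_codeB_le Gr h0 B2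
  have hkt2 : (n * k : ℝ) ≤ kt + n * (m + 1) * (Δ - Module.finrank F B2) := by
    rw [← Nat.cast_sub hdΔ']
    exact_mod_cast h.finrank_eq ▸ le_finrank_codeB Gr h0 B2
  have hdeg := trellisDegree_le (φ := φ) h h0
  have hceil : ∀ j ≤ profileLength k C, ∀ x : ℕ → Fin kt → F, x 0 ≠ 0 →
      ⌈(1 - (k : ℝ) / Δ - ε) * (((j + 1) * n : ℕ) : ℝ)⌉₊ ≤
        ∑ t ∈ Finset.range (j + 1), (Gr.leftSupport (convOutput Gt x t)).card := by
    intro j hj x hx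
    refine Nat.ceil_le.2 ?_
    have := hW j hj x hx
    push_cast
    exact this
  have hpos : ∀ j : ℕ, 0 < (j + 1) * n := fun j => by positivity
  have hconv := convDegree_eq hG hr
  set d : ℝ := (Module.finrank F B2 : ℝ)
  have hkd : (k : ℝ) / Δ ≤ k / d := div_le_div_of_nonneg_left (by positivity) hd0 hdΔ
  have hε : ((m : ℝ) + 1) * ((Δ - d) / d) ≤ ε := by
    rw [← mul_div_assoc, div_le_iff₀ hd0]; exact hd
  have hfrac : (0 : ℝ) ≤ (Δ - d) / d := div_nonneg (by linarith) hd0.le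
  have hkd' : (k : ℝ) / d ≤ k / Δ + (Δ - d) / d := by
    rw [← sub_le_iff_le_add']
    have : (k : ℝ) / d - k / Δ = (k / Δ) * ((Δ - d) / d) := by field_simp
    rw [this]
    exact mul_le_of_le_one_left hfrac ((div_le_one hΔ).2 hkΔ)
  have hm0 : (0 : ℝ) ≤ m := Nat.cast_nonneg m
  have hktd : (kt : ℝ) / d / n ≤ k / d := by
    rw [div_div, div_le_div_iff₀ (by positivity) hd0]
    have := mul_le_mul_of_nonneg_right hkt1 hd0.le
    linarith
  refine ⟨_, ⟨Γ, hΓ⟩, ⟨Γ, hΓ, hdet⟩, ?_, ?_, fun j hj => ?_, fun j hj => ?_⟩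
  · rw [hconv, hm]
    calc trellisDegree (codePhi Gr B2 φ Gt) / n ≤ ((m * kt : ℕ) / d) / n := by gcongr
      _ = m * ((kt : ℝ) / d / n) := by push_cast; ring
      _ ≤ m * (k / Δ + (Δ - d) / d) := mul_le_mul_of_nonneg_left (hktd.trans hkd') hm0
      _ ≤ ((k * m : ℕ) : ℝ) / Δ + ε := by
        push_cast
        have : (k * m : ℝ) / Δ = m * (k / Δ) := by ring
        rw [this]
        linarith
  · rw [logb_natCard_pow φ, abs_le]
    constructor
    · have h1 : (k : ℝ) / d - (m + 1) * ((Δ - d) / d) ≤ kt / d / n := by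
        rw [div_div, le_div_iff₀ (by positivity)]
        have : ((k : ℝ) / d - (m + 1) * ((Δ - d) / d)) * (d * n) =
            n * k - n * (m + 1) * (Δ - d) := by field_simp
        rw [this]
        linarith
      change _ ≤ (kt : ℝ) / d / n - _
      linarith
    · change (kt : ℝ) / d / n - _ ≤ _
      have : (0 : ℝ) ≤ m * ((Δ - d) / d) := by positivity
      linarith
  · exact ofReal_le_div_of_ceil_le (hpos j) (le_columnDist h (hceil j hj))
  · exact ofReal_le_div_of_ceil_le (hpos j) (le_freeDist h (hceil j hj))

end Parameters

end ExpanderTrellis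

end

/-! ### The main theorem: choice of the thresholds -/

open ExpanderTrellis in
theorem mainTheorem6 :
    -- uniform form: the threshold `η` depends only on the memory `m` and the tolerance `ε`
    (∀ (m : ℕ) (ε : ℝ), 0 < ε → ∃ η : ℝ, 0 < η ∧
      ∀ (F : Type u) [Field F] [Finite F] (Δ k : ℕ), 1 ≤ k → k < Δ →
      ∀ (C : Submodule F[X] (Fin Δ → F[X])) (G : Matrix (Fin k) (Fin Δ) F[X]),
        IsConvCode k C → IsMDP k C → IsReducedGenerator C G →
        (∀ i i', rowDegree G i = rowDegree G i') →
        (coeffMatrix G 0).rank = k → memory G = m →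
      ∀ (n : ℕ), 1 ≤ n → ∀ (Gr : BipartiteGraph n Δ) (γ : ℝ), Gr.IsSpectralExpander γ →
      ∀ (B2 : Submodule F (Fin Δ → F)) (K : Type v) [Field K] [Algebra F K] (φ : B2 ≃ₗ[F] K)
        (kt : ℕ) (Gt : Fin (m + 1) → Matrix (Fin kt) Gr.Edge F),
        IsBlockGenerator (codeB m Gr G B2) Gt →
        1 - η ≤ rate B2 → γ ≤ η * √(relDist B2) →
        HasParameters Δ k (convDegree k C) (profileLength k C) (codePhi Gr B2 φ Gt) ε) ∧
    -- for a fixed convolutional code: no error term once `r` and `γ` are close to their limits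
    (∀ (F : Type u) [Field F] [Finite F] (Δ k : ℕ), 1 ≤ k → k < Δ →
      ∀ (C : Submodule F[X] (Fin Δ → F[X])) (G : Matrix (Fin k) (Fin Δ) F[X]),
        IsConvCode k C → IsMDP k C → IsReducedGenerator C G →
        (∀ i i', rowDegree G i = rowDegree G i') →
        (coeffMatrix G 0).rank = k →
      ∃ η : ℝ, 0 < η ∧
      ∀ (n : ℕ), 1 ≤ n → ∀ (Gr : BipartiteGraph n Δ) (γ : ℝ), Gr.IsSpectralExpander γ →
      ∀ (B2 : Submodule F (Fin Δ → F)) (K : Type v) [Field K] [Algebra F K] (φ : B2 ≃ₗ[F] K)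
        (kt : ℕ) (Gt : Fin (memory G + 1) → Matrix (Fin kt) Gr.Edge F),
        IsBlockGenerator (codeB (memory G) Gr G B2) Gt →
        1 - η ≤ rate B2 → γ ≤ η →
        HasParameters Δ k (convDegree k C) (profileLength k C) (codePhi Gr B2 φ Gt) 0) := by
  refine ⟨fun m ε hε => ?_, ?_⟩
  -- The entry ε/4 is for the mixing argument; 1/2 gives dim B₂ ≥ Δ/2; the last entry bounds the
  -- dimension loss (m+1)ηΔ by εΔ/2 ≤ ε dim B₂.
  · refine ⟨min (ε / 4) (min (1 / 2) (ε / (2 * (m + 1)))), by positivity, ?_⟩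
    intro F _ _ Δ k _ hk C G _ hC hG hr h0 hm n hn Gr γ hγ B2 K _ _ φ kt Gt h hrate hγη
    have hB := finrank_pos_of_equiv φ
    have hΔ : (0 : ℝ) < Δ := by exact_mod_cast (Nat.zero_le k).trans_lt hk
    set η := min (ε / 4) (min (1 / 2) (ε / (2 * ((m : ℝ) + 1)))) with hη
    have hη1 : η ≤ ε / 4 := min_le_left _ _
    have hη2 : η ≤ 1 / 2 := (min_le_right _ _).trans (min_le_left _ _)
    have hη3 : η ≤ ε / (2 * ((m : ℝ) + 1)) := (min_le_right _ _).trans (min_le_right _ _)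
    rw [rate, le_div_iff₀ hΔ] at hrate
    refine hasParameters_of_le hk hn hG hr h0 hm h ?_ ?_
    · have h1 : ((m : ℝ) + 1) * (Δ - Module.finrank F B2) ≤ (m + 1) * (η * Δ) :=
        mul_le_mul_of_nonneg_left (by linarith) (by positivity)
      have h2 : (m + 1) * η ≤ ε / 2 := by
        rw [le_div_iff₀ (by positivity)] at hη3
        linarith
      have h3 : (Δ : ℝ) / 2 ≤ Module.finrank F B2 := by
        have := mul_le_mul_of_nonneg_right hη2 hΔ.le
        linarith
      have h4 := mul_le_mul_of_nonneg_right h2 hΔ.le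
      have h5 := mul_le_mul_of_nonneg_left h3 hε.le
      linarith
    · intro j hj x hx
      -- For ε > 1 - k/Δ the distance bound is not positive, hence trivial.
      rcases le_or_gt ε (1 - k / Δ) with hεk | hεk
      · refine le_trans ?_ (le_sum_card_leftSupport hk hn hC hG.1 h0 hm hB h hγ hε hεk
          (hγη.trans (mul_le_mul_of_nonneg_right hη1 (Real.sqrt_nonneg _))) hx hj)
        exact le_add_of_nonneg_right (by positivity)
      · refine le_trans ?_ (Finset.sum_nonneg fun t _ => Nat.cast_nonneg _)
        exact mul_nonpos_of_nonpos_of_nonneg (by linarith) (by positivity)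
  · intro F _ _ Δ k _ hk C G _ hC hG hr h0
    have hΔ : (0 : ℝ) < Δ := by exact_mod_cast (Nat.zero_le k).trans_lt hk
    -- The largest auxiliary error for which ε(j+1)n ≤ n/Δ for all j ≤ L(C), so that the surplus n/Δ
    -- pays for it.
    set ε : ℝ := 1 / (Δ * (profileLength k C + 1)) with hε
    have hε0 : 0 < ε := by positivity
    refine ⟨min (1 / (2 * Δ)) (ε / 4 * √(1 / Δ)), by positivity, ?_⟩
    intro n hn Gr γ hγ B2 K _ _ φ kt Gt h hrate hγη
    have hB := finrank_pos_of_equiv φ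
    -- The dimension is an integer within 1/2 of Δ and at most Δ, so B₂ is the whole space and the
    -- errors in rate and degree vanish.
    have hfin : Module.finrank F B2 = Δ := by
      refine le_antisymm (by simpa using Submodule.finrank_le B2) ?_
      have h1 : 1 - 1 / (2 * (Δ : ℝ)) ≤ rate B2 :=
        (sub_le_sub_left (min_le_left _ _) 1).trans hrate
      rw [rate, le_div_iff₀ hΔ] at h1
      have h2 : (1 - 1 / (2 * (Δ : ℝ))) * Δ = Δ - 1 / 2 := by field_simp
      have h3 : (Δ : ℝ) < Module.finrank F B2 + 1 := by linarith
      exact Nat.lt_succ_iff.1 (by exact_mod_cast h3)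
    refine hasParameters_of_le hk hn hG hr h0 rfl h (by rw [hfin]; simp) ?_
    intro j hj x hx
    have hεk : ε ≤ 1 - k / Δ := by
      have h1 : (k : ℝ) + 1 ≤ Δ := by exact_mod_cast hk
      have h2 : ε ≤ 1 / Δ := by
        refine one_div_le_one_div_of_le hΔ (le_mul_of_one_le_right hΔ.le ?_)
        linarith [Nat.cast_nonneg (α := ℝ) (profileLength k C)]
      refine h2.trans ?_
      rw [one_sub_div hΔ.ne']
      exact div_le_div_of_nonneg_right (by linarith) hΔ.le
    refine le_trans ?_ (le_sum_card_leftSupport hk hn hC hG.1 h0 rfl hB h hγ hε0 hεk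
      (hγη.trans ((min_le_right _ _).trans (mul_le_mul_of_nonneg_left
        (Real.sqrt_le_sqrt (one_div_le_relDist hB)) (by positivity)))) hx hj)
    have h3 : ε * (((j : ℝ) + 1) * n) ≤ n / Δ := by
      have h4 : (j : ℝ) + 1 ≤ profileLength k C + 1 := by exact_mod_cast Nat.succ_le_succ hj
      calc ε * (((j : ℝ) + 1) * n) ≤ ε * ((profileLength k C + 1) * n) := by gcongr
        _ = n / Δ := by rw [hε]; field_simp
    linarith
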